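/- Let $1\le\lambda_1\le\dots\le\lambda_n$ be integers with $\lambda_1+\dots+\lambda_n=N$, and consider the left-justified pyramid with rows of lengths $\lambda_1,\dots,\lambda_n$ from top to bottom, its boxes numbered by $1,\dots,N$ consecutively by rows. Let $e=\sum e_{ab}\in\mathfrak{gl}_N(\mathbb C)$, summed over the pairs such that box $b$ is the right neighbour of box $a$ in the same row, and let $\mathfrak a$ be the centralizer of $e$ in $\mathfrak{gl}_N$. It has the basis $$E_{ij}^{(r)}=\sum_{\mathrm{row}(a)=i,\ \mathrm{row}(b)=j,\ \mathrm{col}(b)-\mathrm{col}(a)=r}e_{ab},\qquad 1\le i,j\le n,\quad \lambda_j-\min(\lambda_i,\lambda_j)\le r<\lambda_j .$$ Put $c_i=\lambda_1+\dots+\lambda_{i-1}+(n-i+1)\lambda_i$ and equip $\mathfrak a$ with the invariant symmetric bilinear form with $\langle E_{ii}^{(0)},E_{jj}^{(0)}\rangle=\min(\lambda_i,\lambda_j)-\delta_{ij}c_i$, with $\langle E_{ij}^{(0)},E_{ji}^{(0)}\rangle=-c_i$ if $i\ne j$ and $\lambda_i=\lambda_j$, and all other values on pairs of basis vectors equal to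 zero. Let $\widehat{\mathfrak a}=\mathfrak a[t,t^{-1}]\oplus\mathbb C\mathbf 1$ with $\mathbf 1$ central and, for $X[r]=Xt^r$, $[X[r],Y[s]]=[X,Y][r+s]+r\,\delta_{r,-s}\langle X,Y\rangle\mathbf 1$. Let $V(\mathfrak a)=\mathrm U(\widehat{\mathfrak a})/\mathrm I$ be the vacuum module, where $\mathrm I$ is the left ideal generated by $\mathfrak a[t]$ and $\mathbf 1-1$, and let $1\in V(\mathfrak a)$ be the vacuum vector. Let $T$ and $\Delta$ be the operators on $V(\mathfrak a)$ with $T1=0$, $\Delta 1=0$ and $$[T,X[r]]=-r\,X[r-1],\qquad [\Delta,X[r]]=r\,X[r+1]\qquad (X\in\mathfrak a,\ r\in\mathbb Z);$$ they are induced by the derivations of $\mathrm U(\widehat{\mathfrak a})$ given on generators by $X[r]\mapsto -r\,X[r-1]$, respectively $X[r]\mapsto r\,X[r+1]$, and $\mathbf 1\mapsto 0$. For $1\le i,j\le n$ let $E_{ij}(u)=\sum_{r=\lambda_j-\min(\lambda_i,\lambda_j)}^{\lambda_j-1}E_{ij}^{(r)}[-1]\,u^r$. With commuting variables $x,u$,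 apply the operator given by the column-determinant $$\sum_{\sigma\in\mathfrak S_n}\mathrm{sgn}\,\sigma\cdot\big(\delta_{\sigma(1)1}(x+\lambda_1T)+E_{\sigma(1)1}(u)\big)\cdots\big(\delta_{\sigma(n)n}(x+\lambda_nT)+E_{\sigma(n)n}(u)\big)$$ to the vacuum vector and write the result as $\phi_0(u)x^n+\phi_1(u)x^{n-1}+\dots+\phi_n(u)$ with $\phi_0(u)=1$ and $\phi_k(u)=\sum_r\phi_k^{(r)}u^r$, $\phi_k^{(r)}\in V(\mathfrak a)$. Then for every $k\in\{1,\dots,n\}$ and every integer $r\ge 0$: 1. if $r>\lambda_{n-k+2}+\dots+\lambda_n-k+1$, then $\Delta\,\phi_k^{(r)}=0$; 2. if $r=\lambda_{n-k+2}+\dots+\lambda_n-k+1$, then $\Delta\,\phi_k^{(r)}=-(k-1)(\lambda_1+\dots+\lambda_{n-k+1})\,\phi_{k-1}^{(r)}$. (For $k=1$ the empty sum $\lambda_{n+1}+\dots+\lambda_n$ is $0$.) -/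

import Mathlib

open scoped TensorProduct

noncomputable section

/-! ### Derivations of enveloping algebras -/

namespace EnvDer

attribute [local instance] LieRing.ofAssociativeRing

variable {R L : Type*} [CommRing R] [LieRing L] [LieAlgebra R L]

/-- The Lie homomorphism `x ↦ x + ε D x` from `L` to the dual numbers over `U(L)` given by a
derivation `D` of the Lie algebra `L`. -/
def toDual (D : LieDerivation R L L) :
    L →ₗ⁅R⁆ TrivSqZeroExt (UniversalEnvelopingAlgebra R L) (UniversalEnvelopingAlgebra R L) where
  toFun x := TrivSqZeroExt.inl (UniversalEnvelopingAlgebra.ι R x) +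
    TrivSqZeroExt.inr (UniversalEnvelopingAlgebra.ι R (D x))
  map_add' x y := by
    ext <;> simp
  map_smul' c x := by
    ext <;> simp
  map_lie' {x y} := by
    ext
    · simp [LieRing.of_associative_ring_bracket, -UniversalEnvelopingAlgebra.ι_apply]
    · simp [LieRing.of_associative_ring_bracket, -UniversalEnvelopingAlgebra.ι_apply]
      abel

/-- The derivation of the associative algebra `U(L)` extending a derivation `D` of `L`. -/
def der (D : LieDerivation R L L) :
    UniversalEnvelopingAlgebra R L →ₗ[R] UniversalEnvelopingAlgebra R L :=
  (TrivSqZeroExt.sndHom (UniversalEnvelopingAlgebra R L) (UniversalEnvelopingAlgebra R L)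
    ).restrictScalars R ∘ₗ (UniversalEnvelopingAlgebra.lift R (toDual D)).toLinearMap

theorem fst_lift (D : LieDerivation R L L) (a : UniversalEnvelopingAlgebra R L) :
    (UniversalEnvelopingAlgebra.lift R (toDual D) a).fst = a := by
  have : (TrivSqZeroExt.fstHom R (UniversalEnvelopingAlgebra R L)
      (UniversalEnvelopingAlgebra R L)).comp (UniversalEnvelopingAlgebra.lift R (toDual D)) =
      AlgHom.id R _ := by
    ext x
    simp [toDual, -UniversalEnvelopingAlgebra.ι_apply, UniversalEnvelopingAlgebra.lift_ι_apply]
  exact DFunLike.congr_fun this a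

theorem der_ι (D : LieDerivation R L L) (x : L) :
    der D (UniversalEnvelopingAlgebra.ι R x) = UniversalEnvelopingAlgebra.ι R (D x) := by
  simp [der, toDual, -UniversalEnvelopingAlgebra.ι_apply, UniversalEnvelopingAlgebra.lift_ι_apply]

theorem der_mul (D : LieDerivation R L L) (a b : UniversalEnvelopingAlgebra R L) :
    der D (a * b) = der D a * b + a * der D b := by
  simp [der, fst_lift, add_comm]

theorem der_one (D : LieDerivation R L L) : der D 1 = 0 := by
  simp [der]

end EnvDer

/-! ### Affine Kac--Moody algebras and their vacuum modules -/

namespace Affine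

open LieAlgebra

variable {g : Type*} [LieRing g] [LieAlgebra ℂ g] (B : LinearMap.BilinForm ℂ g)
  (hB : B.lieInvariant g) (hs : B.IsSymm)

/-- The cocycle `(X tʳ, Y tˢ) ↦ r δ_{r,-s} B(X, Y)`. (Mathlib's cocycle attached to a form has
the opposite sign, it is the residue of `f dg`; hence the form `-B` here.) -/
def cocycle : LieModule.Cohomology.twoCocycle ℂ (loopAlgebra ℂ ℤ g)
    (TrivialLieModule ℂ (loopAlgebra ℂ ℤ g) ℂ) :=
  LoopAlgebra.twoCocycleOfBilinear ℂ ℤ g (-B)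
    (fun x y z => by simp [hB x y z]) ⟨fun x y => by simp [hs.eq y x]⟩

/-- The affine Kac--Moody algebra `ĝ = g[t,t⁻¹] ⊕ ℂ 1`: the central extension of the loop
algebra by the cocycle above. -/
def KM : Type _ := LieAlgebra.ofTwoCocycle (cocycle B hB hs)

instance : LieRing (KM B hB hs) :=
  inferInstanceAs (LieRing (LieAlgebra.ofTwoCocycle (cocycle B hB hs)))

instance : LieAlgebra ℂ (KM B hB hs) :=
  inferInstanceAs (LieAlgebra ℂ (LieAlgebra.ofTwoCocycle (cocycle B hB hs)))

/-- `ĝ` as the vector space `g[t,t⁻¹] ⊕ ℂ`, a Laurent polynomial being given by its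
coefficients. -/
def coords : KM B hB hs ≃ₗ[ℂ] (ℤ →₀ g) × ℂ where
  toFun x := (LoopAlgebra.toFinsupp ℂ ℤ g ((ofProd (cocycle B hB hs)).symm x).1,
    TrivialLieModule.equiv ℂ (loopAlgebra ℂ ℤ g) ℂ ((ofProd (cocycle B hB hs)).symm x).2)
  invFun p := ofProd (cocycle B hB hs) ((LoopAlgebra.toFinsupp ℂ ℤ g).symm p.1,
    (TrivialLieModule.equiv ℂ (loopAlgebra ℂ ℤ g) ℂ).symm p.2)
  map_add' _ _ := Prod.ext (map_add (LoopAlgebra.toFinsupp ℂ ℤ g) _ _) rfl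
  map_smul' c _ := Prod.ext (map_smul (LoopAlgebra.toFinsupp ℂ ℤ g) c _) rfl
  left_inv _ := congrArg (ofProd (cocycle B hB hs))
    (Prod.ext ((LoopAlgebra.toFinsupp ℂ ℤ g).symm_apply_apply _) rfl)
  right_inv p := Prod.ext ((LoopAlgebra.toFinsupp ℂ ℤ g).apply_symm_apply p.1) rfl

/-- The element `X[r] = X tʳ` of `ĝ`. -/
def mon (r : ℤ) : g →ₗ[ℂ] KM B hB hs :=
  (coords B hB hs).symm.toLinearMap ∘ₗ LinearMap.inl ℂ (ℤ →₀ g) ℂ ∘ₗ Finsupp.lsingle r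

/-- The central element `1` of `ĝ`. -/
def central : KM B hB hs := (coords B hB hs).symm (0, 1)

theorem coords_mon (r : ℤ) (X : g) : coords B hB hs (mon B hB hs r X) = (.single r X, 0) :=
  (coords B hB hs).apply_symm_apply _

theorem coords_central : coords B hB hs (central B hB hs) = (0, 1) :=
  (coords B hB hs).apply_symm_apply _

theorem residue_single (r s : ℤ) (X Y : g) :
    LoopAlgebra.residuePairing ℂ ℤ g (-B) ((LoopAlgebra.toFinsupp ℂ ℤ g).symm (.single r X))
      ((LoopAlgebra.toFinsupp ℂ ℤ g).symm (.single s Y)) =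
      if r + s = 0 then (r : ℂ) * B X Y else 0 := by
  simp only [LoopAlgebra.residuePairing_apply_apply, LinearEquiv.apply_symm_apply]
  rw [Finsupp.sum_single_index (by simp)]
  by_cases h : r + s = 0
  · obtain rfl : r = -s := by lia
    simp
  · rw [Finsupp.single_eq_of_ne (by lia)]
    simp [h]

/-- The commutation relations of `ĝ`. -/
theorem mon_lie_mon (r s : ℤ) (X Y : g) :
    ⁅mon B hB hs r X, mon B hB hs s Y⁆ =
      mon B hB hs (r + s) ⁅X, Y⁆ + (if r + s = 0 then (r : ℂ) * B X Y else 0) •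
        central B hB hs := by
  apply (coords B hB hs).injective
  rw [map_add, map_smul, coords_mon, coords_central]
  ext1
  · change LoopAlgebra.toFinsupp ℂ ℤ g ⁅(LoopAlgebra.toFinsupp ℂ ℤ g).symm (.single r X),
      (LoopAlgebra.toFinsupp ℂ ℤ g).symm (.single s Y)⁆ = _
    rw [LoopAlgebra.toFinsupp_symm_single, LoopAlgebra.toFinsupp_symm_single,
      LieAlgebra.ExtendScalars.bracket_tmul, AddMonoidAlgebra.single_mul_single, mul_one,
      LoopAlgebra.toFinsupp_single_tmul]
    split_ifs <;> simp
  · change LoopAlgebra.residuePairing ℂ ℤ g (-B)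
      ((LoopAlgebra.toFinsupp ℂ ℤ g).symm (.single r X))
      ((LoopAlgebra.toFinsupp ℂ ℤ g).symm (.single s Y)) + 0 - 0 = _
    rw [residue_single]
    split_ifs <;> simp

/-- The element `1` is central in `ĝ`. -/
theorem central_lie (x : KM B hB hs) : ⁅central B hB hs, x⁆ = 0 := by
  rw [← lie_skew, neg_eq_zero]
  apply (coords B hB hs).injective
  have h0 : ((ofProd (cocycle B hB hs)).symm (central B hB hs)).1 = 0 :=
    map_zero (LoopAlgebra.toFinsupp ℂ ℤ g).symm
  set f := ((ofProd (cocycle B hB hs)).symm x).1 with hf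
  rw [map_zero]
  ext1
  · change LoopAlgebra.toFinsupp ℂ ℤ g ⁅f,
      ((ofProd (cocycle B hB hs)).symm (central B hB hs)).1⁆ = 0
    rw [h0]
    exact (congrArg _ (lie_zero (L := loopAlgebra ℂ ℤ g) f)).trans (map_zero _)
  · change LoopAlgebra.residuePairing ℂ ℤ g (-B) f
      ((ofProd (cocycle B hB hs)).symm (central B hB hs)).1 + 0 - 0 = 0
    rw [h0, map_zero]
    simp

theorem KM_induction {p : KM B hB hs → Prop} (h0 : p 0)
    (hadd : ∀ x y, p x → p y → p (x + y)) (hmon : ∀ (r : ℤ) (X : g), p (mon B hB hs r X))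
    (hcen : ∀ c : ℂ, p (c • central B hB hs)) (x : KM B hB hs) : p x := by
  obtain ⟨⟨f, c⟩, rfl⟩ := (coords B hB hs).symm.surjective x
  have h : (coords B hB hs).symm (f, c) =
      (coords B hB hs).symm (f, 0) + c • central B hB hs := by
    rw [central, ← map_smul, ← map_add]; simp
  rw [h]
  refine hadd _ _ ?_ (hcen c)
  induction f using Finsupp.induction_linear with
  | zero => simpa using! h0
  | add a b ha hb =>
    have h' : (coords B hB hs).symm (a + b, 0) =
        (coords B hB hs).symm (a, 0) + (coords B hB hs).symm (b, 0) := by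
      rw [← map_add]; simp
    rw [h']
    exact hadd _ _ (ha (by rw [central, ← map_smul, ← map_add]; simp))
      (hb (by rw [central, ← map_smul, ← map_add]; simp))
  | single r X => exact hmon r X

/-- The linear operator on `ĝ` with `X[r] ↦ r X[r+m]` and `1 ↦ 0`. -/
def wittLin (m : ℤ) : KM B hB hs →ₗ[ℂ] KM B hB hs :=
  (Finsupp.lsum ℂ fun r : ℤ => (r : ℂ) • mon B hB hs (r + m)) ∘ₗ
    LinearMap.fst ℂ (ℤ →₀ g) ℂ ∘ₗ (coords B hB hs).toLinearMap

theorem wittLin_mon (m r : ℤ) (X : g) :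
    wittLin B hB hs m (mon B hB hs r X) = (r : ℂ) • mon B hB hs (r + m) X := by
  simp [wittLin, coords_mon]

theorem wittLin_central (m : ℤ) : wittLin B hB hs m (central B hB hs) = 0 := by
  simp [wittLin, coords_central]

/-- The derivation `t^{m+1} d/dt` of `ĝ`: it takes `X[r]` to `r X[r+m]` and `1` to `0`. -/
def witt (m : ℤ) : LieDerivation ℂ (KM B hB hs) (KM B hB hs) where
  toLinearMap := wittLin B hB hs m
  leibniz' x y := by
    have hc (x : KM B hB hs) : ⁅x, central B hB hs⁆ = 0 := by
      rw [← lie_skew, central_lie, neg_zero]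
    induction x using KM_induction with
    | h0 => simp
    | hadd a b ha hb => simp only [add_lie, map_add, lie_add, ha, hb]; abel
    | hcen c => simp [wittLin_central, central_lie]
    | hmon r X =>
      induction y using KM_induction with
      | h0 => simp
      | hadd a b ha hb => simp only [add_lie, map_add, lie_add, ha, hb]; abel
      | hcen c => simp [wittLin_central, central_lie, hc]
      | hmon s Y =>
        simp only [mon_lie_mon, map_add, map_smul, wittLin_mon, wittLin_central, smul_zero,
          lie_smul, smul_add]
        rw [← lie_skew X Y, hs.eq Y X, show s + (r + m) = r + s + m by ring,
          show r + (s + m) = r + s + m by ring]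
        simp only [map_neg]
        by_cases h : r + s + m = 0
        · simp only [h, if_true]
          have : (m : ℂ) = -r - s := by
            have := congrArg (Int.cast (R := ℂ)) h
            push_cast at this
            linear_combination this
          push_cast
          module
        · simp only [h, if_false]
          push_cast
          module

theorem witt_mon (m r : ℤ) (X : g) :
    witt B hB hs m (mon B hB hs r X) = (r : ℂ) • mon B hB hs (r + m) X :=
  wittLin_mon B hB hs m r X

theorem witt_central (m : ℤ) : witt B hB hs m (central B hB hs) = 0 :=
  wittLin_central B hB hs m

/-- The enveloping algebra `U(ĝ)`. -/
abbrev UKM : Type _ := UniversalEnvelopingAlgebra ℂ (KM B hB hs)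

/-- The left ideal of `U(ĝ)` generated by `g[t]` and `1 - 1`, the central element minus the
unit of the algebra. -/
def vacIdeal : Submodule (UKM B hB hs) (UKM B hB hs) :=
  Submodule.span _ ({a | ∃ (r : ℤ) (X : g), 0 ≤ r ∧
    a = UniversalEnvelopingAlgebra.ι ℂ (mon B hB hs r X)} ∪
    {UniversalEnvelopingAlgebra.ι ℂ (central B hB hs) - 1})

/-- The vacuum module `V(g) = U(ĝ) / I`. -/
def Vac : Type _ := UKM B hB hs ⧸ vacIdeal B hB hs

instance : AddCommGroup (Vac B hB hs) :=
  inferInstanceAs (AddCommGroup (UKM B hB hs ⧸ vacIdeal B hB hs))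

instance : Module (UKM B hB hs) (Vac B hB hs) :=
  inferInstanceAs (Module (UKM B hB hs) (UKM B hB hs ⧸ vacIdeal B hB hs))

instance : Module ℂ (Vac B hB hs) :=
  inferInstanceAs (Module ℂ (UKM B hB hs ⧸ vacIdeal B hB hs))

instance : IsScalarTower ℂ (UKM B hB hs) (Vac B hB hs) :=
  inferInstanceAs (IsScalarTower ℂ (UKM B hB hs) (UKM B hB hs ⧸ vacIdeal B hB hs))

instance : SMulCommClass (UKM B hB hs) ℂ (Vac B hB hs) :=
  inferInstanceAs (SMulCommClass (UKM B hB hs) ℂ (UKM B hB hs ⧸ vacIdeal B hB hs))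

/-- The canonical projection `U(ĝ) → V(g)`. -/
def toVac : UKM B hB hs →ₗ[UKM B hB hs] Vac B hB hs := (vacIdeal B hB hs).mkQ

theorem toVac_surjective : Function.Surjective (toVac B hB hs) :=
  (vacIdeal B hB hs).mkQ_surjective

/-- The vacuum vector. -/
def vac : Vac B hB hs := toVac B hB hs 1

/-- The operator of left multiplication by `X[r]` on the vacuum module. -/
def op (r : ℤ) (X : g) : Module.End ℂ (Vac B hB hs) :=
  Algebra.lsmul ℂ ℂ (Vac B hB hs) (UniversalEnvelopingAlgebra.ι ℂ (mon B hB hs r X))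

theorem der_witt_mem (m : ℤ) (hm : -1 ≤ m) (a : UKM B hB hs) (ha : a ∈ vacIdeal B hB hs) :
    EnvDer.der (witt B hB hs m) a ∈ vacIdeal B hB hs := by
  unfold vacIdeal at ha ⊢
  induction ha using Submodule.span_induction with
  | zero => simp
  | add a b _ _ ha hb => rw [map_add]; exact add_mem ha hb
  | smul c a h ha =>
    rw [smul_eq_mul, EnvDer.der_mul]
    exact add_mem (Submodule.smul_mem _ _ h) (Submodule.smul_mem _ _ ha)
  | mem a h =>
    rcases h with ⟨r, X, hr, rfl⟩ | rfl
    · rw [EnvDer.der_ι, witt_mon, map_smul]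
      rcases hr.eq_or_lt with rfl | hr
      · simp
      · exact Submodule.smul_of_tower_mem _ _
          (Submodule.subset_span (Or.inl ⟨r + m, X, by lia, rfl⟩))
    · rw [map_sub, EnvDer.der_ι, witt_central, EnvDer.der_one]
      simp

/-- The operator on `V(g)` induced by the derivation of `U(ĝ)` extending `t^{m+1} d/dt`. -/
def wittOp (m : ℤ) (hm : -1 ≤ m) : Module.End ℂ (Vac B hB hs) :=
  ((vacIdeal B hB hs).restrictScalars ℂ).mapQ ((vacIdeal B hB hs).restrictScalars ℂ)
    (EnvDer.der (witt B hB hs m)) fun a ha => der_witt_mem B hB hs m hm a ha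

theorem wittOp_toVac (m : ℤ) (hm : -1 ≤ m) (a : UKM B hB hs) :
    wittOp B hB hs m hm (toVac B hB hs a) = toVac B hB hs (EnvDer.der (witt B hB hs m) a) := rfl

theorem wittOp_vac (m : ℤ) (hm : -1 ≤ m) : wittOp B hB hs m hm (vac B hB hs) = 0 := by
  rw [vac, wittOp_toVac, EnvDer.der_one, map_zero]

/-- The commutation relations `[t^{m+1} d/dt, X[r]] = r X[r+m]` of operators on `V(g)`. -/
theorem wittOp_op (m : ℤ) (hm : -1 ≤ m) (r : ℤ) (X : g) (v : Vac B hB hs) :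
    wittOp B hB hs m hm (op B hB hs r X v) =
      op B hB hs r X (wittOp B hB hs m hm v) + (r : ℂ) • op B hB hs (r + m) X v := by
  obtain ⟨a, rfl⟩ := toVac_surjective B hB hs v
  simp only [op, Algebra.lsmul_coe, wittOp_toVac, ← map_smul (toVac B hB hs), smul_eq_mul,
    EnvDer.der_mul, EnvDer.der_ι, witt_mon, map_smul]
  rw [map_add, add_comm, smul_mul_assoc, LinearMap.map_smul_of_tower]

end Affine

/-! ### The centralizer of a nilpotent matrix -/

namespace Pyramid

attribute [local instance] LieRing.ofAssociativeRing

variable {n : ℕ} (lam : Fin n → ℕ)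

/-- The boxes of the left-justified pyramid with rows of lengths `lam 0, lam 1, …`: a box is given
by its row and its column. Rows and columns are numbered from `0`. The boxes are used as they are
to index matrices, instead of the numbers `1, …, N` written into them. -/
abbrev Box : Type := (i : Fin n) × Fin (lam i)

/-- The Lie algebra `gl_N`. -/
abbrev gl : Type := Matrix (Box lam) (Box lam) ℂ

/-- The nilpotent matrix `e` with Jordan blocks of sizes `lam i`: the sum of the matrix units
`e_{ab}` such that `b` is the right neighbour of `a`. -/
def nilp : gl lam :=
  Matrix.of fun a b => if a.1 = b.1 ∧ (b.2 : ℕ) = a.2 + 1 then 1 else 0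

/-- The centralizer `𝔞` of `e` in `gl_N`. -/
def centralizer : LieSubalgebra ℂ (gl lam) where
  carrier := {X | ⁅nilp lam, X⁆ = 0}
  add_mem' hx hy := by
    simp only [Set.mem_ofPred_eq] at hx hy ⊢
    rw [lie_add, hx, hy, add_zero]
  zero_mem' := lie_zero _
  smul_mem' c x hx := by
    simp only [Set.mem_ofPred_eq] at hx ⊢
    rw [lie_smul, hx, smul_zero]
  lie_mem' {x y} hx hy := by
    simp only [Set.mem_ofPred_eq] at hx hy ⊢
    rw [leibniz_lie, hx, hy, zero_lie, lie_zero, add_zero]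

theorem nilp_mul_apply (X : gl lam) (i k : Fin n) (c : ℕ) (hc : c < lam i) (d : Fin (lam k)) :
    (nilp lam * X) ⟨i, ⟨c, hc⟩⟩ ⟨k, d⟩ =
      if h : c + 1 < lam i then X ⟨i, ⟨c + 1, h⟩⟩ ⟨k, d⟩ else 0 := by
  rw [Matrix.mul_apply]
  split_ifs with h
  · rw [Finset.sum_eq_single ⟨i, ⟨c + 1, h⟩⟩]
    · simp [nilp]
    · rintro ⟨j, f⟩ - hb
      have : ¬ (i = j ∧ (f : ℕ) = c + 1) := by
        rintro ⟨rfl, hf⟩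
        exact hb (by congr 1; exact Fin.ext hf)
      simp [nilp, this]
    · simp
  · refine Finset.sum_eq_zero ?_
    rintro ⟨j, f⟩ -
    have : ¬ (i = j ∧ (f : ℕ) = c + 1) := by
      rintro ⟨rfl, hf⟩
      exact h (hf ▸ f.2)
    simp [nilp, this]

theorem mul_nilp_apply_succ (X : gl lam) (a : Box lam) (k : Fin n) (d : ℕ)
    (hd : d + 1 < lam k) :
    (X * nilp lam) a ⟨k, ⟨d + 1, hd⟩⟩ = X a ⟨k, ⟨d, by lia⟩⟩ := by
  rw [Matrix.mul_apply, Finset.sum_eq_single ⟨k, ⟨d, by lia⟩⟩]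
  · simp [nilp]
  · rintro ⟨j, f⟩ - hb
    have : ¬ (j = k ∧ d = (f : ℕ)) := by
      rintro ⟨rfl, hf⟩
      exact hb (by congr 1; exact Fin.ext hf.symm)
    simp [nilp, this]
  · simp

theorem mul_nilp_apply_zero (X : gl lam) (a : Box lam) (k : Fin n) (hd : 0 < lam k) :
    (X * nilp lam) a ⟨k, ⟨0, hd⟩⟩ = 0 := by
  rw [Matrix.mul_apply]
  exact Finset.sum_eq_zero fun b _ => by simp [nilp]

variable {lam} in
theorem comm_of_mem {X : gl lam} (hX : X ∈ centralizer lam) : nilp lam * X = X * nilp lam :=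
  sub_eq_zero.mp hX

/-- The elements `E_{ij}^{(r)}`, for `lam j - min (lam i) (lam j) ≤ r`; for the other values of
`r`, where this matrix does not belong to the centralizer, the value is `0`. Note that
`E_{ij}^{(r)} = 0` for `r ≥ lam j`, the sum being empty. -/
def Emat (i j : Fin n) (r : ℕ) : gl lam :=
  if lam j - min (lam i) (lam j) ≤ r then
    Matrix.of fun a b => if a.1 = i ∧ b.1 = j ∧ (b.2 : ℕ) = a.2 + r then 1 else 0
  else 0

theorem Emat_mem (i j : Fin n) (r : ℕ) : Emat lam i j r ∈ centralizer lam := by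
  change nilp lam * Emat lam i j r - Emat lam i j r * nilp lam = 0
  rw [sub_eq_zero]
  unfold Emat
  split_ifs with hr
  · ext ⟨k, c, hc⟩ ⟨l, d, hd⟩
    rw [nilp_mul_apply]
    rcases d with _ | d
    · rw [mul_nilp_apply_zero]
      split_ifs
      · simp only [Matrix.of_apply]
        rw [if_neg (by lia)]
      · rfl
    · rw [mul_nilp_apply_succ]
      simp only [Matrix.of_apply]
      split_ifs with h1 h2 h3 h3 h3 <;> first | rfl | (exfalso; grind)
  · simp

/-- The elements `E_{ij}^{(r)}` of the Lie algebra `𝔞`. -/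
def E (i j : Fin n) (r : ℕ) : centralizer lam := ⟨Emat lam i j r, Emat_mem lam i j r⟩

/-- The number of boxes in the first `lam i` columns of the pyramid. It is equal to
`lam 1 + … + lam (i-1) + (n - i + 1) lam i` if `lam 1 ≤ … ≤ lam n`. -/
def boxes (i : Fin n) : ℕ := ∑ l, min (lam l) (lam i)

theorem boxes_congr {i j : Fin n} (h : lam i = lam j) : boxes lam i = boxes lam j := by
  simp only [boxes, h]

section Form

variable [∀ i, NeZero (lam i)]

/-- The coefficient of `E_{ij}^{(0)}` in an element of `𝔞`, read off from its entry in the first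
boxes of the rows `i` and `j` (it is zero if `lam i < lam j`). -/
def coeff (i j : Fin n) : centralizer lam →ₗ[ℂ] ℂ where
  toFun X := (X : gl lam) ⟨i, ⟨0, Nat.pos_of_neZero _⟩⟩ ⟨j, ⟨0, Nat.pos_of_neZero _⟩⟩
  map_add' _ _ := rfl
  map_smul' _ _ := rfl

theorem coeff_E (i j k l : Fin n) (r : ℕ) :
    coeff lam i j (E lam k l r) =
      if k = i ∧ l = j ∧ r = 0 ∧ lam j ≤ lam i then 1 else 0 := by
  change Emat lam k l r ⟨i, ⟨0, Nat.pos_of_neZero _⟩⟩ ⟨j, ⟨0, Nat.pos_of_neZero _⟩⟩ = _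
  unfold Emat
  by_cases h1 : lam l - min (lam k) (lam l) ≤ r
  · rw [if_pos h1, Matrix.of_apply]
    refine if_congr ⟨?_, ?_⟩ rfl rfl
    · rintro ⟨rfl, rfl, h⟩
      exact ⟨rfl, rfl, by lia, by lia⟩
    · rintro ⟨rfl, rfl, rfl, h⟩
      exact ⟨rfl, rfl, rfl⟩
  · rw [if_neg h1, if_neg]
    · rfl
    · rintro ⟨rfl, rfl, rfl, h⟩
      lia

theorem coeff_eq_zero (X : centralizer lam) {i j : Fin n} (h : lam i < lam j) :
    coeff lam i j X = 0 := by
  have hc := comm_of_mem X.2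
  have key : ∀ c (hc : c < lam i), (X : gl lam) ⟨i, ⟨0, Nat.pos_of_neZero _⟩⟩
      ⟨j, ⟨0, Nat.pos_of_neZero _⟩⟩ = (X : gl lam) ⟨i, ⟨c, hc⟩⟩ ⟨j, ⟨c, by lia⟩⟩ := by
    intro c hci
    induction c with
    | zero => rfl
    | succ c ih =>
      have := congrFun (congrFun hc ⟨i, ⟨c, by lia⟩⟩) ⟨j, ⟨c + 1, by lia⟩⟩
      rw [nilp_mul_apply, mul_nilp_apply_succ, dif_pos hci] at this
      rw [ih (by lia), this]
  have hi := Nat.pos_of_neZero (lam i)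
  have := congrFun (congrFun hc ⟨i, ⟨lam i - 1, by lia⟩⟩) ⟨j, ⟨(lam i - 1) + 1, by lia⟩⟩
  rw [nilp_mul_apply, mul_nilp_apply_succ, dif_neg (by lia)] at this
  change (X : gl lam) _ _ = 0
  rw [key (lam i - 1) (by lia), ← this]

theorem entry_eq_zero (X : centralizer lam) (i j : Fin n) (c : ℕ) (hc : c + 1 < lam i) :
    (X : gl lam) ⟨i, ⟨c + 1, hc⟩⟩ ⟨j, ⟨0, Nat.pos_of_neZero _⟩⟩ = 0 := by
  have := congrFun (congrFun (comm_of_mem X.2) ⟨i, ⟨c, by lia⟩⟩) ⟨j, ⟨0, Nat.pos_of_neZero _⟩⟩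
  rwa [nilp_mul_apply, mul_nilp_apply_zero, dif_pos hc] at this

theorem coeff_mul (X Y : centralizer lam) (i j : Fin n) :
    ((X : gl lam) * (Y : gl lam)) ⟨i, ⟨0, Nat.pos_of_neZero _⟩⟩ ⟨j, ⟨0, Nat.pos_of_neZero _⟩⟩ =
      ∑ k, coeff lam i k X * coeff lam k j Y := by
  rw [Matrix.mul_apply, Fintype.sum_sigma]
  refine Finset.sum_congr rfl fun k _ => ?_
  rw [Finset.sum_eq_single ⟨0, Nat.pos_of_neZero _⟩]
  · rfl
  · rintro ⟨c, hc⟩ - h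
    rcases c with _ | c
    · exact absurd rfl h
    · rw [entry_eq_zero, mul_zero]
  · simp

theorem coeff_lie (X Y : centralizer lam) (i j : Fin n) :
    coeff lam i j ⁅X, Y⁆ = ∑ k, (coeff lam i k X * coeff lam k j Y -
      coeff lam i k Y * coeff lam k j X) := by
  rw [Finset.sum_sub_distrib, ← coeff_mul, ← coeff_mul]
  rfl

/-- The normalized Killing form on `𝔞` at the critical level, in terms of the coefficients of the
basis elements. -/
def form : LinearMap.BilinForm ℂ (centralizer lam) :=
  LinearMap.mk₂ ℂ (fun X Y =>
    (∑ i, ∑ j, ((min (lam i) (lam j) : ℕ) : ℂ) * (coeff lam i i X * coeff lam j j Y)) -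
      ∑ i, ∑ j, (if lam i = lam j then (boxes lam i : ℂ) else 0) *
        (coeff lam i j X * coeff lam j i Y))
  (fun _ _ _ => by simp only [map_add, add_mul, mul_add, Finset.sum_add_distrib]; ring)
  (fun _ _ _ => by
    simp only [map_smul, smul_eq_mul, mul_sub, Finset.mul_sum]
    congr 1 <;> exact Finset.sum_congr rfl fun _ _ => Finset.sum_congr rfl fun _ _ => by ring)
  (fun _ _ _ => by simp only [map_add, mul_add, Finset.sum_add_distrib]; ring)
  (fun _ _ _ => by
    simp only [map_smul, smul_eq_mul, mul_sub, Finset.mul_sum]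
    congr 1 <;> exact Finset.sum_congr rfl fun _ _ => Finset.sum_congr rfl fun _ _ => by ring)

theorem form_apply (X Y : centralizer lam) : form lam X Y =
    (∑ i, ∑ j, ((min (lam i) (lam j) : ℕ) : ℂ) * (coeff lam i i X * coeff lam j j Y)) -
      ∑ i, ∑ j, (if lam i = lam j then (boxes lam i : ℂ) else 0) *
        (coeff lam i j X * coeff lam j i Y) := rfl

theorem form_isSymm : (form lam).IsSymm := ⟨fun X Y => by
  simp only [form_apply]
  congr 1
  · rw [Finset.sum_comm]
    refine Finset.sum_congr rfl fun i _ => Finset.sum_congr rfl fun j _ => ?_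
    rw [min_comm]
    ring
  · rw [Finset.sum_comm]
    refine Finset.sum_congr rfl fun i _ => Finset.sum_congr rfl fun j _ => ?_
    by_cases h : lam i = lam j
    · rw [if_pos h, if_pos h.symm, boxes_congr lam h]
      ring
    · rw [if_neg h, if_neg (Ne.symm h)]
      ring⟩

theorem diag_lie (X Y : centralizer lam) (j : Fin n) :
    ∑ i, ((min (lam i) (lam j) : ℕ) : ℂ) * coeff lam i i ⁅X, Y⁆ = 0 := by
  simp only [coeff_lie, mul_sub, Finset.mul_sum, Finset.sum_sub_distrib]
  rw [sub_eq_zero]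
  nth_rw 2 [Finset.sum_comm]
  refine Finset.sum_congr rfl fun i _ => Finset.sum_congr rfl fun k _ => ?_
  rcases lt_trichotomy (lam i) (lam k) with h | h | h
  · simp [coeff_eq_zero lam _ h]
  · rw [h, mul_comm (coeff lam k i Y)]
  · simp [coeff_eq_zero lam _ h]

theorem weight_eq (X Y : centralizer lam) (i j k : Fin n) :
    (if lam i = lam j then (boxes lam i : ℂ) else 0) * (coeff lam i k X * coeff lam k j Y) =
      (if lam i = lam j ∧ lam j = lam k then (boxes lam i : ℂ) else 0) *
        (coeff lam i k X * coeff lam k j Y) := by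
  by_cases h : lam i = lam j
  · by_cases hk : lam j = lam k
    · simp [h, hk]
    · rcases lt_or_gt_of_ne hk with hk | hk
      · rw [coeff_eq_zero lam X (h ▸ hk : lam i < lam k)]; simp
      · rw [coeff_eq_zero lam Y hk]; simp
  · simp [h]

theorem form_lieInvariant : (form lam).lieInvariant (centralizer lam) := by
  intro X Y Z
  have h1 : ∑ i, ∑ j, ((min (lam i) (lam j) : ℕ) : ℂ) *
      (coeff lam i i ⁅X, Y⁆ * coeff lam j j Z) = 0 := by
    rw [Finset.sum_comm]
    refine Finset.sum_eq_zero fun j _ => ?_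
    simp only [← mul_assoc, ← Finset.sum_mul, diag_lie, zero_mul]
  have h2 : ∑ i, ∑ j, ((min (lam i) (lam j) : ℕ) : ℂ) *
      (coeff lam i i Y * coeff lam j j ⁅X, Z⁆) = 0 := by
    refine Finset.sum_eq_zero fun i _ => ?_
    simp only [mul_left_comm _ (coeff lam i i Y), ← Finset.mul_sum, min_comm (lam i), diag_lie,
      mul_zero]
  have h3 : ∑ i, ∑ j, (if lam i = lam j then (boxes lam i : ℂ) else 0) *
      (coeff lam i j ⁅X, Y⁆ * coeff lam j i Z) =
      (∑ i, ∑ j, ∑ k, (if lam i = lam j ∧ lam j = lam k then (boxes lam i : ℂ) else 0) *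
        (coeff lam i k X * coeff lam k j Y * coeff lam j i Z)) -
      ∑ i, ∑ j, ∑ k, (if lam i = lam j ∧ lam j = lam k then (boxes lam i : ℂ) else 0) *
        (coeff lam i k Y * coeff lam k j X * coeff lam j i Z) := by
    simp only [← Finset.sum_sub_distrib]
    refine Finset.sum_congr rfl fun i _ => Finset.sum_congr rfl fun j _ => ?_
    rw [coeff_lie, Finset.sum_mul, Finset.mul_sum]
    refine Finset.sum_congr rfl fun k _ => ?_
    linear_combination coeff lam j i Z * weight_eq lam X Y i j k -
      coeff lam j i Z * weight_eq lam Y X i j k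
  have h4 : ∑ i, ∑ j, (if lam i = lam j then (boxes lam i : ℂ) else 0) *
      (coeff lam i j Y * coeff lam j i ⁅X, Z⁆) =
      (∑ i, ∑ k, ∑ j, (if lam j = lam i ∧ lam i = lam k then (boxes lam j : ℂ) else 0) *
        (coeff lam i j Y * coeff lam j k X * coeff lam k i Z)) -
      ∑ k, ∑ j, ∑ i, (if lam j = lam i ∧ lam i = lam k then (boxes lam j : ℂ) else 0) *
        (coeff lam k i X * coeff lam i j Y * coeff lam j k Z) := by
    have hc : ∑ k, ∑ j, ∑ i, (if lam j = lam i ∧ lam i = lam k then (boxes lam j : ℂ) else 0) *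
        (coeff lam k i X * coeff lam i j Y * coeff lam j k Z) =
        ∑ i, ∑ k, ∑ j, (if lam j = lam i ∧ lam i = lam k then (boxes lam j : ℂ) else 0) *
        (coeff lam k i X * coeff lam i j Y * coeff lam j k Z) := by
      rw [Finset.sum_congr rfl fun k _ => Finset.sum_comm, Finset.sum_comm]
    rw [hc]
    simp only [← Finset.sum_sub_distrib]
    refine Finset.sum_congr rfl fun i _ => ?_
    rw [Finset.sum_comm]
    refine Finset.sum_congr rfl fun j _ => ?_
    rw [coeff_lie, Finset.mul_sum, Finset.mul_sum]
    refine Finset.sum_congr rfl fun k _ => ?_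
    have hw : (if lam i = lam j then (boxes lam i : ℂ) else 0) =
        if lam j = lam i then (boxes lam j : ℂ) else 0 := by
      by_cases h : lam i = lam j
      · rw [if_pos h, if_pos h.symm, boxes_congr lam h]
      · rw [if_neg h, if_neg (Ne.symm h)]
    rw [hw]
    linear_combination coeff lam i j Y * weight_eq lam X Z j i k -
      coeff lam i j Y * weight_eq lam Z X j i k
  rw [form_apply, form_apply, h1, h2, h3, h4]
  have hw (i j k : Fin n) : (if lam k = lam i ∧ lam i = lam j then (boxes lam k : ℂ) else 0) =
      if lam i = lam j ∧ lam j = lam k then (boxes lam i : ℂ) else 0 := by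
    by_cases h : lam i = lam j ∧ lam j = lam k
    · rw [if_pos h, if_pos (by lia), boxes_congr lam (h.1.trans h.2)]
    · rw [if_neg h, if_neg (by lia)]
  have e1 : ∑ i, ∑ k, ∑ j, (if lam j = lam i ∧ lam i = lam k then (boxes lam j : ℂ) else 0) *
        (coeff lam i j Y * coeff lam j k X * coeff lam k i Z) =
      ∑ i, ∑ j, ∑ k, (if lam i = lam j ∧ lam j = lam k then (boxes lam i : ℂ) else 0) *
        (coeff lam i k Y * coeff lam k j X * coeff lam j i Z) :=
    Finset.sum_congr rfl fun i _ => Finset.sum_congr rfl fun j _ =>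
      Finset.sum_congr rfl fun k _ => by rw [hw]
  have e2 : ∑ k, ∑ j, ∑ i, (if lam j = lam i ∧ lam i = lam k then (boxes lam j : ℂ) else 0) *
        (coeff lam k i X * coeff lam i j Y * coeff lam j k Z) =
      ∑ i, ∑ j, ∑ k, (if lam i = lam j ∧ lam j = lam k then (boxes lam i : ℂ) else 0) *
        (coeff lam i k X * coeff lam k j Y * coeff lam j i Z) :=
    Finset.sum_congr rfl fun i _ => Finset.sum_congr rfl fun j _ =>
      Finset.sum_congr rfl fun k _ => by rw [← hw j k i]
  rw [e1, e2]
  ring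

end Form

end Pyramid

/-! ### The column-determinant and its coefficients -/

/-- The column-determinant of a square matrix over a ring which need not be commutative. -/
def columnDet {A : Type*} [Ring A] {n : ℕ} (M : Matrix (Fin n) (Fin n) A) : A :=
  ∑ σ : Equiv.Perm (Fin n), ((Equiv.Perm.sign σ : ℤ) : A) * (List.ofFn fun j => M (σ j) j).prod

namespace Pyramid

open Polynomial

variable {n : ℕ} (lam : Fin n → ℕ) [∀ i, NeZero (lam i)]

/-- The vacuum module at the critical level over the affine Kac--Moody algebra of `𝔞`. -/
abbrev V : Type _ := Affine.Vac (form lam) (form_lieInvariant lam) (form_isSymm lam)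

/-- The vacuum vector, the unit `1` of `V(𝔞) ≅ U(t⁻¹𝔞[t⁻¹])`. -/
def vac : V lam := Affine.vac _ _ _

/-- The operator of multiplication by `X[r]` on the vacuum module. -/
def op (r : ℤ) (X : centralizer lam) : Module.End ℂ (V lam) := Affine.op _ _ _ r X

/-- The translation operator: `[T, X[r]] = -r X[r-1]` and `T 1 = 0`. -/
def T : Module.End ℂ (V lam) := -Affine.wittOp _ _ _ (-1) le_rfl

/-- The operator on `V(𝔞)` induced by the derivation `Δ` of the enveloping algebra of the
Kac--Moody algebra: `[Δ, X[r]] = r X[r+1]` and `Δ 1 = 0`. -/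
def Delta : Module.End ℂ (V lam) := Affine.wittOp _ _ _ 1 (by norm_num)

/-- The polynomial `E_{ij}(u)`, the sum of `E_{ij}^{(r)}[-1] u^r` over
`lam j - min (lam i) (lam j) ≤ r < lam j`. The coefficients are regarded as operators on `V(𝔞)`,
so that they can be multiplied with each other and with `T`. -/
def Epoly (i j : Fin n) : (Module.End ℂ (V lam))[X] :=
  ∑ r ∈ Finset.Ico (lam j - min (lam i) (lam j)) (lam j), monomial r (op lam (-1) (E lam i j r))

/-- The matrix with the entries `δ_{ij} (x + lam i T) + E_{ij}(u)`. The outer polynomial variable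
is `x` and the inner one is `u`. -/
def mat : Matrix (Fin n) (Fin n) (Module.End ℂ (V lam))[X][X] :=
  Matrix.of fun i j => (if i = j then X + C (C ((lam i : ℂ) • T lam)) else 0) + C (Epoly lam i j)

/-- The element `φ_k^{(r)}` of `V(𝔞)`: the coefficient of `x^{n-k} u^r` in the
column-determinant, applied to the vacuum vector. For `k = 0` this is the coefficient of
`x^n u^r`, so `φ_0(u) = 1`. -/
def phi (k r : ℕ) : V lam := (((columnDet (mat lam)).coeff (n - k)).coeff r) (vac lam)

end Pyramid

end

/-!
The column-determinant is expanded into principal minors: `φ_k^{(r)}` is the sum over the sets `J`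
of `k` columns of the coefficient of `u ^ r` in the minor on `J` of the matrix `e` with the entries
`δ_{ij} lam_j T + E_{ij}(u)`, applied to the vacuum vector. The column `j` of `e` has degree at most
`lam j - 1` in `u`, so a minor on `J` has degree at most `∑ j ∈ J, (lam j - 1)`. The number in the
statement which `r` is compared with is the largest of these bounds for the sets of `k - 1` columns.

The commutator of `Δ` with `e_{ij}` is `2 δ_{ij} lam_j t d/dt - F_{ij}(u)`, where `F_{ij}(u)` is
`E_{ij}(u)` with the zero modes `X[0]` in place of `X[-1]`. It annihilates the vacuum vector, and
moving it to the right only involves the Lie bracket of `𝔞`, never the bilinear form. So `Δ` takes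
the minor on a set of `k` columns to products in which a column `m` is removed and a column `p > m`
is modified (`Lowering.smul_app_oprod`). These products have `k - 1` nontrivial columns, and in the
degrees `r` considered only the top coefficients of the columns contribute. There the modified
column is `lam m` or `lam p` times a column of `e`, up to a summand with `T` and up to its place in
the product (`Lowering.sum_app_update`). The matrix of top coefficients is a Manin matrix, so that
the place of a column does not matter (`OrderedProd.sum_oprod_comp`); the terms with `T` cancel
(`Lowering.sum_app_pair`). A pair `m < p` of columns in `J` thus contributes the minors on `J \ {m}`
and `J \ {p}` with the factors `-lam m` and `-lam p`. Summation over the pairs gives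
`-(k - 1)` times the sum of the minors on sets of `k - 1` columns, each multiplied by the sum of
`lam m` over its complement (`Lowering.smul_sum_app_minor`). If the coefficient of `u ^ r` in the
minor is nonzero, then the degree bound is attained, and this sum is the sum of the first
`n - k + 1` of the numbers `lam m`.
-/

/-! ### Ordered products -/

namespace OrderedProd

open Polynomial Equiv Finset

variable {n : ℕ} {A : Type*} [Ring A]

/-- The product `f 0 * f 1 * ⋯ * f (n - 1)` in a ring which need not be commutative, as a
multilinear map. -/
def oprod (n : ℕ) (A : Type*) [Ring A] : MultilinearMap ℤ (fun _ : Fin n => A) A :=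
  MultilinearMap.mkPiAlgebraFin ℤ n A

theorem oprod_apply (f : Fin n → A) : oprod n A f = (List.ofFn f).prod :=
  MultilinearMap.mkPiAlgebraFin_apply f

theorem oprod_eq_map (f : Fin n → A) : oprod n A f = ((List.finRange n).map f).prod := by
  rw [oprod_apply, List.ofFn_eq_map]

theorem oprod_zero (f : Fin 0 → A) : oprod 0 A f = 1 := by
  simp [oprod_apply]

theorem oprod_cons (a : A) (f : Fin n → A) :
    oprod (n + 1) A (Fin.cons a f) = a * oprod n A f := by
  simp [oprod_apply]

theorem exists_cons {B : Type*} (f : Fin (n + 1) → B) :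
    ∃ (a : B) (g : Fin n → B), f = Fin.cons a g :=
  ⟨f 0, Fin.tail f, (Fin.cons_self_tail f).symm⟩

/-- Left multiplication by `D` is moved through an ordered product by the Leibniz rule. -/
theorem comm_oprod (D : A) (f : Fin n → A) :
    D * oprod n A f - oprod n A f * D =
      ∑ m, oprod n A (Function.update f m (D * f m - f m * D)) := by
  induction n with
  | zero => simp [oprod_zero]
  | succ n ih =>
    obtain ⟨a, f, rfl⟩ := exists_cons f
    rw [Fin.sum_univ_succ, Fin.update_cons_zero]
    simp only [Fin.cons_zero, Fin.cons_succ, ← Fin.cons_update, oprod_cons, ← mul_sum, ← ih]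
    noncomm_ring

/-- A factor `F` of an ordered product is moved to its right end by the Leibniz rule. -/
theorem oprod_update_sub (F : A) (f : Fin n → A) (m : Fin n) :
    oprod n A (Function.update f m F) - oprod n A (Function.update f m 1) * F =
      ∑ p, if m < p then oprod n A
        (Function.update (Function.update f m 1) p (F * f p - f p * F)) else 0 := by
  induction n with
  | zero => exact m.elim0
  | succ n ih =>
    obtain ⟨a, f, rfl⟩ := exists_cons f
    rw [Fin.sum_univ_succ]
    induction m using Fin.cases with
    | zero =>
      simp only [Fin.update_cons_zero, Fin.cons_succ, ← Fin.cons_update, oprod_cons, one_mul,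
        lt_irrefl, if_false, Fin.succ_pos, if_true, comm_oprod, zero_add]
    | succ m =>
      simp only [Fin.cons_succ, ← Fin.cons_update, oprod_cons, Fin.succ_lt_succ_iff,
        Fin.not_lt_zero, if_false, zero_add, mul_assoc, ← mul_sub, ih, mul_sum]
      exact sum_congr rfl fun p _ => by split_ifs <;> simp

theorem oprod_mul_of_commute (z f : Fin n → A) (hz : ∀ j a, Commute (z j) a) :
    oprod n A (fun j => z j * f j) = oprod n A z * oprod n A f := by
  induction n with
  | zero => simp [oprod_zero]
  | succ n ih =>
    have hc (g : Fin (n + 1) → A) : g = Fin.cons (g 0) fun j => g j.succ :=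
      (Fin.cons_self_tail g).symm
    have hcomm : Commute (oprod n A fun j => z j.succ) (f 0) := by
      rw [oprod_apply]
      refine Commute.list_prod_left _ _ fun a ha => ?_
      obtain ⟨j, rfl⟩ := (List.mem_ofFn' _ _).mp ha
      exact hz _ _
    rw [hc fun j => z j * f j, hc z, hc f]
    simp only [oprod_cons, Fin.cons_zero, Fin.cons_succ]
    rw [ih (fun j => z j.succ) (fun j => f j.succ) fun j => hz _]
    rw [mul_assoc, mul_assoc, ← mul_assoc (f 0), ← hcomm.eq, mul_assoc]

theorem map_oprod {B : Type*} [Ring B] (φ : A →+* B) (f : Fin n → A) :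
    φ (oprod n A f) = oprod n B fun j => φ (f j) := by
  simp [oprod_eq_map, map_list_prod, Function.comp_def]

/-- The degree of an ordered product of polynomials, and its coefficient in the top degree. -/
theorem natDegree_coeff_oprod (f : Fin n → A[X]) (d : Fin n → ℕ)
    (hd : ∀ j, (f j).natDegree ≤ d j) :
    (oprod n A[X] f).natDegree ≤ ∑ j, d j ∧
      (oprod n A[X] f).coeff (∑ j, d j) = oprod n A fun j => (f j).coeff (d j) := by
  induction n with
  | zero => simp [oprod_zero]
  | succ n ih =>
    obtain ⟨h1, h2⟩ := ih (fun j => f j.succ) (fun j => d j.succ) fun j => hd _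
    have hc {B : Type _} (g : Fin (n + 1) → B) : g = Fin.cons (g 0) fun j => g j.succ :=
      (Fin.cons_self_tail g).symm
    rw [hc f, hc fun j => (Fin.cons (f 0) (fun j => f j.succ) : Fin (n + 1) → A[X]) j |>.coeff (d j)]
    simp only [oprod_cons, Fin.cons_zero, Fin.cons_succ, Fin.sum_univ_succ]
    exact ⟨natDegree_mul_le_of_le (hd 0) h1, by
      rw [coeff_mul_add_eq_of_natDegree_le (hd 0) h1, h2]⟩

theorem coeff_oprod (f : Fin n → A[X]) (d : Fin n → ℕ) (hd : ∀ j, (f j).natDegree ≤ d j)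
    (r : ℕ) (hr : ∑ j, d j ≤ r) :
    (oprod n A[X] f).coeff r =
      if ∑ j, d j = r then oprod n A fun j => (f j).coeff (d j) else 0 := by
  obtain ⟨h1, h2⟩ := natDegree_coeff_oprod f d hd
  split_ifs with h
  · rw [← h, h2]
  · exact coeff_eq_zero_of_natDegree_lt (by lia)

/-! ### Principal minors -/

/-- The permutations which fix every point outside `J`. -/
def fixing (J : Finset (Fin n)) : Finset (Perm (Fin n)) := {σ | ∀ j ∉ J, σ j = j}

theorem mem_fixing {J : Finset (Fin n)} {σ : Perm (Fin n)} :
    σ ∈ fixing J ↔ ∀ j ∉ J, σ j = j := by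
  simp [fixing]

theorem apply_mem {J : Finset (Fin n)} {σ : Perm (Fin n)} (hσ : σ ∈ fixing J) {j : Fin n}
    (hj : j ∈ J) : σ j ∈ J := by
  by_contra h
  exact h ((σ.injective (mem_fixing.mp hσ _ h)).symm ▸ hj)

/-- The factors of the summand of a principal minor indexed by `σ`: the entry in the row `σ j` of
the column `j` if `j ∈ J`, and `1` for the other columns, so that they may be kept in the
product. -/
def entry (J : Finset (Fin n)) (e : Fin n → Fin n → A) (σ : Perm (Fin n)) (j : Fin n) : A :=
  if j ∈ J then e (σ j) j else 1

/-- The column-determinant of the submatrix of `e` with the rows and columns in `J`. -/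
def minor (J : Finset (Fin n)) (e : Fin n → Fin n → A) : A :=
  ∑ σ ∈ fixing J, (Perm.sign σ : ℤ) • oprod n A (entry J e σ)

/-- The coefficients of the characteristic polynomial of a matrix over a ring which need not be
commutative are the sums of the principal minors. -/
theorem coeff_columnDet (e : Fin n → Fin n → A) (k : ℕ) (hk : k ≤ n) :
    (columnDet (Matrix.of fun i j => (if i = j then X else 0) + C (e i j))).coeff (n - k) =
      ∑ J ∈ powersetCard k univ, minor J e := by
  have key (σ : Perm (Fin n)) (J : Finset (Fin n)) :
      oprod n A[X] (J.piecewise (fun j => C (e (σ j) j)) fun j => if σ j = j then X else 0) =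
        if σ ∈ fixing J then X ^ (n - #J) * C (oprod n A (entry J e σ)) else 0 := by
    split_ifs with h
    · have h1 : J.piecewise (fun j => C (e (σ j) j)) (fun j => if σ j = j then X else 0) =
          fun j => (if j ∈ J then 1 else X) * C (entry J e σ j) := by
        ext1 j
        by_cases hj : j ∈ J
        · simp [hj, entry]
        · simp [hj, entry, mem_fixing.mp h j hj]
      rw [h1, oprod_mul_of_commute, map_oprod]
      · congr 1
        have h2 (l : List (Fin n)) : (l.map fun j => if j ∈ J then (1 : A[X]) else X).prod =
            X ^ (l.filter (· ∉ J)).length := by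
          induction l with
          | nil => simp
          | cons a l ih =>
            by_cases ha : a ∈ J
            · simp [ha, ih]
            · simp [ha, ih, pow_succ']
        rw [oprod_eq_map, h2]
        congr 1
        have h3 : ((List.finRange n).filter (· ∉ J)).toFinset = Jᶜ := by ext; simp
        rw [← List.toFinset_card_of_nodup ((List.nodup_finRange n).filter _), h3, card_compl,
          Fintype.card_fin]
      · intro j a
        split_ifs
        · exact Commute.one_left a
        · exact commute_X a
    · simp only [mem_fixing, not_forall] at h
      obtain ⟨j, hj, hσ⟩ := h
      exact MultilinearMap.map_coord_zero _ j (by simp [hj, hσ])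
  have h1 (σ : Perm (Fin n)) : (List.ofFn fun j =>
      (Matrix.of fun i j => (if i = j then (X : A[X]) else 0) + C (e i j)) (σ j) j).prod =
      ∑ J : Finset (Fin n), if σ ∈ fixing J then
        X ^ (n - #J) * C (oprod n A (entry J e σ)) else 0 := by
    rw [← sum_congr rfl fun J _ => key σ J, ← MultilinearMap.map_add_univ, oprod_apply]
    congr 2
    ext1 j
    simp [add_comm]
  simp only [columnDet, h1, minor]
  rw [finsetSum_coeff]
  simp only [← zsmul_eq_mul, smul_sum, finsetSum_coeff, coeff_smul]
  rw [sum_comm, ← sum_subset (subset_univ (powersetCard k univ))]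
  · refine sum_congr rfl fun J hJ => ?_
    rw [← sum_subset (subset_univ (fixing J)) fun σ _ hσ => by simp [hσ]]
    refine sum_congr rfl fun σ hσ => ?_
    rw [if_pos hσ, (mem_powersetCard.mp hJ).2, coeff_X_pow_mul', if_pos le_rfl, Nat.sub_self,
      coeff_C_zero]
  · intro J _ hJ
    refine sum_eq_zero fun σ _ => ?_
    split_ifs
    · have hJn : #J ≤ n := by simpa using card_le_univ J
      have hne : #J ≠ k := fun h => hJ (mem_powersetCard.mpr ⟨subset_univ J, h⟩)
      rw [coeff_X_pow_mul']
      split_ifs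
      · rw [coeff_C_of_ne_zero (by lia), smul_zero]
      · simp
    · simp

theorem sign_mul_swap_smul {M : Type*} [AddCommGroup M] {i j : Fin n} (h : i ≠ j)
    (σ : Perm (Fin n)) (x : M) :
    (Perm.sign (σ * swap i j) : ℤ) • x = -((Perm.sign σ : ℤ) • x) := by
  simp [Perm.sign_swap h]

theorem mul_swap_mem_fixing {J : Finset (Fin n)} {σ : Perm (Fin n)} (hσ : σ ∈ fixing J)
    {i j : Fin n} (hi : i ∈ J) (hj : j ∈ J) : σ * swap i j ∈ fixing J := by
  refine mem_fixing.mpr fun q hq => ?_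
  rw [Perm.mul_apply, swap_apply_of_ne_of_ne (by grind) (by grind), mem_fixing.mp hσ q hq]

theorem entry_mul_swap {J : Finset (Fin n)} (e : Fin n → Fin n → A) (σ : Perm (Fin n))
    {i j q : Fin n} (hi : q ≠ i) (hj : q ≠ j) : entry J e (σ * swap i j) q = entry J e σ q := by
  simp [entry, swap_apply_of_ne_of_ne hi hj]

/-- The principal minors of a Manin matrix do not depend on the order of the columns. -/
theorem sum_map_prod_perm (J : Finset (Fin n)) (e : Fin n → Fin n → A)
    (he : ∀ i j k l, e i j * e k l - e k l * e i j = e k j * e i l - e i l * e k j)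
    {l l' : List (Fin n)} (hl : l.Perm l') (w : List (Fin n)) (hn : (w ++ l).Nodup) :
    ∑ σ ∈ fixing J, (Perm.sign σ : ℤ) • ((w ++ l).map (entry J e σ)).prod =
      ∑ σ ∈ fixing J, (Perm.sign σ : ℤ) • ((w ++ l').map (entry J e σ)).prod := by
  induction hl generalizing w with
  | nil => rfl
  | cons x _ ih =>
    have := ih (w ++ [x]) (by simpa using hn)
    simpa using this
  | trans h1 _ ih1 ih2 =>
    exact (ih1 w hn).trans (ih2 w ((h1.append_left w).nodup_iff.mp hn))
  | swap i j l =>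
    have hij : j ≠ i := by
      have := (List.nodup_append.mp hn).2.1
      simp only [List.nodup_cons, List.mem_cons, not_or] at this
      exact this.1.1
    simp only [List.map_append, List.prod_append, List.map_cons, List.prod_cons]
    by_cases hi : i ∈ J
    swap
    · exact sum_congr rfl fun σ _ => by simp [entry, hi]
    by_cases hj : j ∈ J
    swap
    · exact sum_congr rfl fun σ _ => by simp [entry, hj]
    rw [← sub_eq_zero, ← sum_sub_distrib]
    -- The terms of `σ` and of `σ * swap i j` cancel.
    refine sum_involution (fun σ _ => σ * swap i j) ?_ ?_ ?_ ?_
    · intro σ hσ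
      have hw : (w.map (entry J e (σ * swap i j))) = w.map (entry J e σ) := by
        refine List.map_congr_left fun q hq => entry_mul_swap e σ ?_ ?_
        · rintro rfl
          exact (List.nodup_append.mp hn).2.2 _ hq _ (by simp) rfl
        · rintro rfl
          exact (List.nodup_append.mp hn).2.2 _ hq _ (by simp) rfl
      have hl : (l.map (entry J e (σ * swap i j))) = l.map (entry J e σ) := by
        have hh := (List.nodup_append.mp hn).2.1
        refine List.map_congr_left fun q hq => entry_mul_swap e σ ?_ ?_
        · rintro rfl
          simp [hq] at hh
        · rintro rfl
          simp [hq] at hh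
      rw [sign_mul_swap_smul hij.symm, sign_mul_swap_smul hij.symm, hw, hl]
      have h := he (σ j) j (σ i) i
      have h' : e (σ j) j * e (σ i) i = e (σ i) i * e (σ j) j + e (σ i) j * e (σ j) i -
          e (σ j) i * e (σ i) j := by
        rw [add_sub_assoc, ← h]; abel
      simp only [entry, hi, hj, if_true, Perm.mul_apply, swap_apply_left, swap_apply_right,
        ← mul_assoc (e _ _) (e _ _), h']
      simp only [add_mul, mul_add, sub_mul, mul_sub, smul_add, smul_sub]
      abel
    · intro σ hσ _ h
      have := congrArg (· j) (mul_eq_left.mp h)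
      simp only [swap_apply_right, Perm.one_apply] at this
      exact hij this.symm
    · exact fun σ hσ => mul_swap_mem_fixing hσ hi hj
    · intro σ _
      rw [mul_assoc, swap_mul_self, mul_one]

theorem sum_oprod_comp (J : Finset (Fin n)) (e : Fin n → Fin n → A)
    (he : ∀ i j k l, e i j * e k l - e k l * e i j = e k j * e i l - e i l * e k j)
    (τ : Perm (Fin n)) :
    ∑ σ ∈ fixing J, (Perm.sign σ : ℤ) • oprod n A (fun q => entry J e σ (τ q)) = minor J e := by
  have hp : ((List.finRange n).map τ).Perm (List.finRange n) :=
    (List.perm_ext_iff_of_nodup ((List.nodup_finRange n).map τ.injective)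
      (List.nodup_finRange n)).mpr fun a => by simpa using τ.surjective a
  have := sum_map_prod_perm J e he hp [] (by simpa using (List.nodup_finRange n).map τ.injective)
  simpa [minor, oprod_eq_map, Function.comp_def] using this

end OrderedProd

/-! ### Lowering operators on column-determinants -/

namespace Lowering

open Polynomial Equiv Finset OrderedProd

variable {n : ℕ} {R M : Type*} [Ring R] [AddCommGroup M] [Module R M]

/-- The coefficient of `u ^ r` of a polynomial in `u` with coefficients in `R`, applied to a
vector `v`. -/
def app (v : M) (r : ℕ) : R[X] →+ M where
  toFun p := p.coeff r • v
  map_zero' := by simp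
  map_add' p q := by simp [add_smul]

theorem app_apply (v : M) (r : ℕ) (p : R[X]) : app v r p = p.coeff r • v := rfl

theorem app_mul_eq_zero {v : M} {q : R[X]} (hq : ∀ r, q.coeff r • v = 0) (p : R[X]) (r : ℕ) :
    app v r (p * q) = 0 := by
  simp [app_apply, coeff_mul, sum_smul, mul_smul, hq]

/-- A commutator with `D` takes the factors `f m` to elements `K m` which annihilate `v`; thus `D`
takes the product of the factors to a combination of products which are obtained by removing one
factor `f m` and taking the commutator of `K m` with a factor to the right of it. -/
theorem smul_app_oprod {v : M} {D : R} (hD : D • v = 0) (f K : Fin n → R[X])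
    (hK : ∀ m, C D * f m - f m * C D = K m) (hv : ∀ m r, (K m).coeff r • v = 0) (r : ℕ) :
    D • app v r (oprod n R[X] f) = ∑ m, ∑ p, if m < p then app v r (oprod n R[X]
      (Function.update (Function.update f m 1) p (K m * f p - f p * K m))) else 0 := by
  have h1 : D • app v r (oprod n R[X] f) =
      app v r (C D * oprod n R[X] f - oprod n R[X] f * C D) := by
    simp [app_apply, sub_smul, mul_smul, hD]
  rw [h1, comm_oprod, map_sum]
  refine sum_congr rfl fun m _ => ?_
  have h2 := congrArg (app v r) (oprod_update_sub (K m) f m)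
  rw [map_sub, app_mul_eq_zero (hv m), sub_zero, map_sum] at h2
  rw [hK, h2]
  exact sum_congr rfl fun p _ => by split_ifs <;> simp

/-- The relations used to compute the action of `D` on a column-determinant: `e` is the matrix
without the variable `x`, `G` its commutator with `D`, and the commutators of `G` with `e` are
expressed by polynomials `H i j l`, for which only the degree and the coefficient in the top degree
are relevant. -/
structure Relations (lam : Fin n → ℕ) (e G : Fin n → Fin n → R[X])
    (H : Fin n → Fin n → Fin n → R[X]) (T D : R) (v : M) : Prop where
  natDegree_e : ∀ i j, (e i j).natDegree ≤ lam j - 1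
  natDegree_H : ∀ i j l, (H i j l).natDegree ≤ lam l - 1
  coeff_H : ∀ i j l, lam j ≤ lam i → lam j ≤ lam l → (H i j l).coeff (lam l - 1) =
    (lam j : ℤ) • ((e i l).coeff (lam l - 1) - if i = l ∧ lam l = 1 then T else 0)
  manin : ∀ i j k l, (e i j).coeff (lam j - 1) * (e k l).coeff (lam l - 1) -
    (e k l).coeff (lam l - 1) * (e i j).coeff (lam j - 1) =
    (e k j).coeff (lam j - 1) * (e i l).coeff (lam l - 1) -
    (e i l).coeff (lam l - 1) * (e k j).coeff (lam j - 1)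
  D_smul : D • v = 0
  comm_D : ∀ i j, C D * e i j - e i j * C D = G i j
  G_smul : ∀ i j r, (G i j).coeff r • v = 0
  comm_G : ∀ i j k l, G i j * e k l - e k l * G i j =
    (if i = j then (-2 * lam j : ℤ) • e k l else 0) - (if k = j then H i j l else 0) +
      if i = l then H k i j else 0

variable {lam : Fin n → ℕ} {e G : Fin n → Fin n → R[X]} {H : Fin n → Fin n → Fin n → R[X]}
  {T D : R} {v : M}

/-- The coefficients of `e` in the top degrees of the columns; they form a Manin matrix. -/
def top (lam : Fin n → ℕ) (e : Fin n → Fin n → R[X]) (i j : Fin n) : R :=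
  (e i j).coeff (lam j - 1)

theorem sum_degree (lam : Fin n → ℕ) (J : Finset (Fin n)) (τ : Perm (Fin n)) :
    ∑ q, (if τ q ∈ J then lam (τ q) - 1 else 0) = ∑ j ∈ J, (lam j - 1) := by
  rw [Equiv.sum_comp τ fun j => if j ∈ J then lam j - 1 else 0]
  simp

theorem coeff_entry (J : Finset (Fin n)) (σ : Perm (Fin n)) (j : Fin n) :
    (entry J e σ j).coeff (if j ∈ J then lam j - 1 else 0) = entry J (top lam e) σ j := by
  unfold entry
  split_ifs <;> simp [top]

theorem natDegree_entry_le (h : Relations lam e G H T D v) (J : Finset (Fin n))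
    (σ : Perm (Fin n)) (j : Fin n) :
    (entry J e σ j).natDegree ≤ if j ∈ J then lam j - 1 else 0 := by
  unfold entry
  split_ifs
  · exact h.natDegree_e _ _
  · simp

theorem app_minor (h : Relations lam e G H T D v) {J : Finset (Fin n)} {r : ℕ}
    (hr : ∑ j ∈ J, (lam j - 1) ≤ r) : app v r (minor J e) =
      if ∑ j ∈ J, (lam j - 1) = r then minor J (top lam e) • v else 0 := by
  have key (σ : Perm (Fin n)) :=
    coeff_oprod (entry J e σ) _ (natDegree_entry_le h J σ) r (by simpa using hr)
  simp only [coeff_entry, sum_ite_mem, univ_inter] at key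
  simp only [app_apply, minor, finsetSum_coeff, coeff_smul, key]
  split_ifs <;> simp

/-- The contribution of a polynomial `H` placed in the column `y`, moved to another place by a
permutation of the columns. If the degree `r` is attained then `H` is a multiple of
the entry of the column `y` without its summand `T`, and the column may be moved back. -/
theorem sum_app_update (h : Relations lam e G H T D v) {J : Finset (Fin n)} {r : ℕ}
    (hr : ∑ j ∈ J, (lam j - 1) ≤ r) {x y : Fin n} (hy : y ∈ J)
    (hx : ∑ j ∈ J, (lam j - 1) = r → ∀ i ∈ J, lam x ≤ lam i) (τ : Perm (Fin n)) :
    ∑ σ ∈ fixing J, (Perm.sign σ : ℤ) • app v r (oprod n R[X]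
      (Function.update (fun q => entry J e σ (τ q)) (τ.symm y) (H (σ y) x y))) =
    (lam x : ℤ) • (app v r (minor J e) -
      if ∑ j ∈ J, (lam j - 1) = r ∧ lam y = 1 then
        (∑ σ ∈ fixing (J.erase y), (Perm.sign σ : ℤ) • oprod n R
          (Function.update (fun q => entry (J.erase y) (top lam e) σ (τ q)) (τ.symm y) T)) • v
      else 0) := by
  have hH (σ : Perm (Fin n)) : (oprod n R[X]
      (Function.update (fun q => entry J e σ (τ q)) (τ.symm y) (H (σ y) x y))).coeff r =
      if ∑ j ∈ J, (lam j - 1) = r then oprod n R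
        (Function.update (fun q => entry J (top lam e) σ (τ q)) (τ.symm y)
          ((H (σ y) x y).coeff (lam y - 1))) else 0 := by
    rw [coeff_oprod _ (fun q => if τ q ∈ J then lam (τ q) - 1 else 0) _ r
      ((sum_degree lam J τ).trans_le hr), sum_degree]
    · congr 2
      ext1 q
      rcases eq_or_ne q (τ.symm y) with rfl | hq
      · simp [hy]
      · simp [hq, coeff_entry]
    · intro q
      rcases eq_or_ne q (τ.symm y) with rfl | hq
      · simpa [hy] using h.natDegree_H _ _ _
      · simpa [hq] using natDegree_entry_le h J σ (τ q)
  rw [app_minor h hr]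
  simp only [app_apply, hH]
  by_cases ht : ∑ j ∈ J, (lam j - 1) = r
  swap
  · simp [ht]
  have hmul (σ : Perm (Fin n)) (hσ : σ ∈ fixing J) : oprod n R
      (Function.update (fun q => entry J (top lam e) σ (τ q)) (τ.symm y)
          ((H (σ y) x y).coeff (lam y - 1))) =
      (lam x : ℤ) • (oprod n R (fun q => entry J (top lam e) σ (τ q)) -
        if σ y = y ∧ lam y = 1 then oprod n R
          (Function.update (fun q => entry J (top lam e) σ (τ q)) (τ.symm y) T) else 0) := by
    rw [h.coeff_H _ _ _ (hx ht _ (apply_mem hσ hy)) (hx ht _ hy), MultilinearMap.map_update_smul,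
      MultilinearMap.map_update_sub]
    congr 2
    · congr 1
      refine Function.update_eq_self_iff.mpr ?_
      simp [entry, hy, top]
    · split_ifs <;> simp
  simp only [ht, if_true, true_and]
  rw [← sum_oprod_comp J (top lam e) h.manin τ]
  simp only [← smul_assoc, ← sum_smul]
  rw [sum_congr rfl fun σ hσ => by rw [hmul σ hσ]]
  simp only [smul_comm _ (lam x : ℤ) (_ : R), ← smul_sum, smul_sub, sum_sub_distrib, smul_assoc,
    sub_smul]
  congr 2
  split_ifs with hl
  swap
  · simp [hl]
  · simp only [hl, and_true, smul_ite, smul_zero, ← sum_filter]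
    congr 1
    refine sum_congr ?_ ?_
    · ext σ
      simp only [mem_filter, mem_fixing, mem_erase]
      grind
    · intro σ hσ
      congr 2
      ext1 q
      rcases eq_or_ne q (τ.symm y) with rfl | hq
      · simp
      · have : τ q ≠ y := fun h => hq (by simp [← h])
        simp [hq, entry, this]

/-- The summands of `D • app v r (minor J e)` for a removed column `m` and a column `p`, in terms
of the minors obtained by removing `m` or `p`. -/
theorem sum_app_update_update {J : Finset (Fin n)} {m p : Fin n} (hm : m ∈ J) (hp : p ∈ J)
    (hmp : m ≠ p) (r : ℕ) :
    ∑ σ ∈ fixing J, (Perm.sign σ : ℤ) • app v r (oprod n R[X]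
      (Function.update (Function.update (entry J e σ) m 1) p
        ((if σ m = m then (-2 * lam m : ℤ) • e (σ p) p else 0) -
          (if σ p = m then H (σ m) m p else 0) + if σ m = p then H (σ p) (σ m) m else 0))) =
    (-2 * lam m : ℤ) • app v r (minor (J.erase m) e) +
      ∑ σ ∈ fixing (J.erase m), (Perm.sign σ : ℤ) • app v r (oprod n R[X]
        (Function.update (entry (J.erase m) e σ) p (H (σ p) m p))) -
      ∑ σ ∈ fixing (J.erase p), (Perm.sign σ : ℤ) • app v r (oprod n R[X]
        (Function.update (fun q => entry (J.erase p) e σ (swap m p q)) p (H (σ m) p m))) := by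
  have hfix {j : Fin n} : fixing (J.erase j) = {σ ∈ fixing J | σ j = j} := by
    ext σ
    simp only [mem_filter, mem_fixing, mem_erase]
    grind
  have hsplit (σ : Perm (Fin n)) : app v r (oprod n R[X]
      (Function.update (Function.update (entry J e σ) m 1) p
        ((if σ m = m then (-2 * lam m : ℤ) • e (σ p) p else 0) -
          (if σ p = m then H (σ m) m p else 0) + if σ m = p then H (σ p) (σ m) m else 0))) =
      (if σ m = m then (-2 * lam m : ℤ) • app v r (oprod n R[X]
        (Function.update (Function.update (entry J e σ) m 1) p (e (σ p) p))) else 0) -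
      (if σ p = m then app v r (oprod n R[X]
        (Function.update (Function.update (entry J e σ) m 1) p (H (σ m) m p))) else 0) +
      if σ m = p then app v r (oprod n R[X]
        (Function.update (Function.update (entry J e σ) m 1) p (H (σ p) p m))) else 0 := by
    rw [MultilinearMap.map_update_add, MultilinearMap.map_update_sub, map_add, map_sub]
    congr 1
    · congr 1
      · split_ifs
        · rw [MultilinearMap.map_update_smul, map_zsmul]
        · simp
      · split_ifs <;> simp
    · split_ifs with hs <;> simp [hs]
  -- Substitute `σ * swap m p` for `σ`: it exchanges the rows of the columns `m` and `p`.
  have hswap (g : Perm (Fin n) → M) :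
      ∑ σ ∈ fixing J, (Perm.sign σ : ℤ) • g σ =
        -∑ σ ∈ fixing J, (Perm.sign σ : ℤ) • g (σ * swap m p) := by
    rw [← sum_neg_distrib]
    refine sum_nbij' (· * swap m p) (· * swap m p) (fun σ hσ => mul_swap_mem_fixing hσ hm hp)
      (fun σ hσ => mul_swap_mem_fixing hσ hm hp) ?_ ?_ ?_
    · exact fun σ _ => by rw [mul_assoc, swap_mul_self, mul_one]
    · exact fun σ _ => by rw [mul_assoc, swap_mul_self, mul_one]
    · exact fun σ _ => by
        rw [sign_mul_swap_smul hmp, neg_neg, mul_assoc, swap_mul_self, mul_one]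
  simp only [hsplit, smul_add, smul_sub, sum_add_distrib, sum_sub_distrib]
  rw [hswap fun σ => if σ p = m then app v r (oprod n R[X]
      (Function.update (Function.update (entry J e σ) m 1) p (H (σ m) m p))) else 0,
    hswap fun σ => if σ m = p then app v r (oprod n R[X]
      (Function.update (Function.update (entry J e σ) m 1) p (H (σ p) p m))) else 0, sub_neg_eq_add,
    ← sub_eq_add_neg]
  simp only [Perm.mul_apply, swap_apply_left, swap_apply_right, smul_ite, smul_zero,
    ← sum_filter, ← hfix]
  congr 1
  · congr 1
    · simp only [minor, map_sum, smul_sum, map_zsmul]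
      refine sum_congr rfl fun σ _ => ?_
      rw [smul_comm]
      congr 4
      ext1 q
      rcases eq_or_ne q p with rfl | hq
      · simp [entry, hp, hmp.symm]
      rcases eq_or_ne q m with rfl | hq'
      · simp [entry, hmp]
      · simp [entry, hq, hq']
    · refine sum_congr rfl fun σ _ => ?_
      congr 3
      ext1 q
      rcases eq_or_ne q p with rfl | hq
      · simp
      rcases eq_or_ne q m with rfl | hq'
      · simp [entry, hmp]
      · simp [entry, hq, hq', swap_apply_of_ne_of_ne]
  · refine sum_congr rfl fun σ _ => ?_
    congr 3
    ext1 q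
    rcases eq_or_ne q p with rfl | hq
    · simp
    rcases eq_or_ne q m with rfl | hq'
    · simp [entry, hmp]
    · simp [entry, hq, hq', swap_apply_of_ne_of_ne]

/-- The minimality of the complement of a set whose degree is maximal. -/
theorem le_of_sum_eq (hpos : ∀ i, 0 < lam i) {k r : ℕ}
    (hr : ∀ J : Finset (Fin n), #J + 1 = k → ∑ j ∈ J, (lam j - 1) ≤ r) {J : Finset (Fin n)}
    (hJ : #J + 1 = k) (ht : ∑ j ∈ J, (lam j - 1) = r) {x i : Fin n} (hx : x ∉ J) (hi : i ∈ J) :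
    lam x ≤ lam i := by
  have hx' : x ∉ J.erase i := fun h => hx (mem_of_mem_erase h)
  have h1 := hr (insert x (J.erase i)) (by
    rw [card_insert_of_notMem hx', card_erase_add_one hi, hJ])
  rw [sum_insert hx'] at h1
  have h2 := add_sum_erase J (fun j => lam j - 1) hi
  have := hpos x
  have := hpos i
  lia

/-- The contribution of a pair of columns `m < p` to `D • app v r (minor J e)`, if `r` is not less
than the degrees of the minors on sets with one column less. -/
theorem sum_app_pair (h : Relations lam e G H T D v) (hlam : Monotone lam)
    (hpos : ∀ i, 0 < lam i) {k r : ℕ}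
    (hr : ∀ J : Finset (Fin n), #J + 1 = k → ∑ j ∈ J, (lam j - 1) ≤ r) {J : Finset (Fin n)}
    (hJ : #J = k) {m p : Fin n} (hm : m ∈ J) (hp : p ∈ J) (hmp : m < p) :
    ∑ σ ∈ fixing J, (Perm.sign σ : ℤ) • app v r (oprod n R[X]
      (Function.update (Function.update (entry J e σ) m 1) p
        (G (σ m) m * e (σ p) p - e (σ p) p * G (σ m) m))) =
    -((lam m : ℤ) • app v r (minor (J.erase m) e) +
      (lam p : ℤ) • app v r (minor (J.erase p) e)) := by
  have hJm : #(J.erase m) + 1 = k := by rw [card_erase_add_one hm, hJ]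
  have hJp : #(J.erase p) + 1 = k := by rw [card_erase_add_one hp, hJ]
  have hpm : p ∈ J.erase m := mem_erase.mpr ⟨hmp.ne', hp⟩
  have hmp' : m ∈ J.erase p := mem_erase.mpr ⟨hmp.ne, hm⟩
  have h1 := sum_app_update h (hr _ hJm) hpm
    (fun ht i hi => le_of_sum_eq hpos hr hJm ht (notMem_erase m J) hi) (Equiv.refl _)
  have h2 := sum_app_update h (hr _ hJp) hmp'
    (fun ht i hi => le_of_sum_eq hpos hr hJp ht (notMem_erase p J) hi) (swap m p)
  simp only [refl_apply, refl_symm, symm_swap, swap_apply_left] at h1 h2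
  simp only [h.comm_G]
  rw [sum_app_update_update hm hp hmp.ne, h1, h2]
  -- The terms with `T` cancel: they are present only if `lam m = lam p = 1`.
  have hcorr : (∑ σ ∈ fixing ((J.erase p).erase m), (Perm.sign σ : ℤ) • oprod n R
      (Function.update (fun q => entry ((J.erase p).erase m) (top lam e) σ (swap m p q)) p T)) =
      ∑ σ ∈ fixing ((J.erase m).erase p), (Perm.sign σ : ℤ) • oprod n R
      (Function.update (entry ((J.erase m).erase p) (top lam e) σ) p T) := by
    rw [erase_right_comm]
    refine sum_congr rfl fun σ _ => ?_
    congr 2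
    ext1 q
    rcases eq_or_ne q p with rfl | hq
    · simp
    rcases eq_or_ne q m with rfl | hq'
    · simp [entry, hmp.ne]
    · simp [hq, swap_apply_of_ne_of_ne hq' hq]
  rw [hcorr]
  have hs := (add_sum_erase J (fun j => lam j - 1) hm).trans
    (add_sum_erase J (fun j => lam j - 1) hp).symm
  have hle := hlam hmp.le
  have hm0 := hpos m
  have hp0 := hpos p
  have hiff : (∑ j ∈ J.erase m, (lam j - 1) = r ∧ lam p = 1) ↔
      (∑ j ∈ J.erase p, (lam j - 1) = r ∧ lam m = 1) := by
    constructor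
    · rintro ⟨ht, hl⟩
      exact ⟨by lia, by lia⟩
    · rintro ⟨ht, hl⟩
      have := le_of_sum_eq hpos hr hJp ht (notMem_erase p J) hmp'
      exact ⟨by lia, by lia⟩
  by_cases hc : ∑ j ∈ J.erase m, (lam j - 1) = r ∧ lam p = 1
  · have hlm := (hiff.mp hc).2
    rw [if_pos hc, if_pos (hiff.mp hc), hlm, hc.2, Nat.cast_one, one_smul, one_smul, one_smul,
      one_smul, mul_one, neg_smul, two_smul]
    abel
  · rw [if_neg hc, if_neg fun h => hc (hiff.mpr h)]
    module

theorem sum_pairs (J : Finset (Fin n)) (g : Fin n → M) :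
    ∑ m ∈ J, ∑ p ∈ J, (if m < p then g m + g p else 0) = (#J - 1 : ℤ) • ∑ m ∈ J, g m := by
  have h1 : ∑ m ∈ J, ∑ p ∈ J, (if m < p then g m + g p else 0) =
      ∑ m ∈ J, ∑ p ∈ J, ((if m < p then g m else 0) + if p < m then g m else 0) := by
    simp only [sum_add_distrib]
    nth_rw 3 [sum_comm]
    simp only [← sum_add_distrib]
    exact sum_congr rfl fun m _ => sum_congr rfl fun p _ => by split_ifs <;> simp
  rw [h1, smul_sum]
  refine sum_congr rfl fun m hm => ?_
  have h2 (p : Fin n) : ((if m < p then g m else 0) + if p < m then g m else 0) =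
      g m - if p = m then g m else 0 := by
    rcases lt_trichotomy m p with h | h | h
    · simp [h, h.ne', h.not_gt]
    · simp [h]
    · simp [h, h.ne, h.not_gt]
  simp only [h2, sum_sub_distrib, sum_const, sum_ite_eq', hm, if_true]
  rw [sub_smul, one_smul, natCast_zsmul]

theorem smul_app_minor (h : Relations lam e G H T D v) (hlam : Monotone lam)
    (hpos : ∀ i, 0 < lam i) {k r : ℕ}
    (hr : ∀ J : Finset (Fin n), #J + 1 = k → ∑ j ∈ J, (lam j - 1) ≤ r) {J : Finset (Fin n)}
    (hJ : #J = k) :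
    D • app v r (minor J e) =
      -((k - 1 : ℤ) • ∑ m ∈ J, (lam m : ℤ) • app v r (minor (J.erase m) e)) := by
  rw [← hJ, ← sum_pairs, ← sum_neg_distrib, minor, map_sum, smul_sum]
  simp only [map_zsmul]
  have key (σ : Perm (Fin n)) : D • app v r (oprod n R[X] (entry J e σ)) =
      ∑ m ∈ J, ∑ p ∈ J, if m < p then app v r (oprod n R[X]
      (Function.update (Function.update (entry J e σ) m 1) p
        (G (σ m) m * e (σ p) p - e (σ p) p * G (σ m) m))) else 0 := by
    rw [smul_app_oprod h.D_smul (entry J e σ) (fun m => if m ∈ J then G (σ m) m else 0)]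
    · rw [← sum_subset (subset_univ J) fun m _ hm => by simp [hm]]
      refine sum_congr rfl fun m hm => ?_
      rw [← sum_subset (subset_univ J) fun p _ hp => by simp [hp, entry]]
      exact sum_congr rfl fun p hp => by simp [hp, hm, entry]
    · intro m
      unfold entry
      split_ifs
      · exact h.comm_D _ _
      · simp
    · intro m r
      split_ifs
      · exact h.G_smul _ _ _
      · simp
  simp only [smul_comm D (_ : ℤ) (_ : M), key, smul_sum]
  rw [sum_comm]
  refine sum_congr rfl fun m hm => ?_
  rw [sum_comm, ← sum_neg_distrib]
  refine sum_congr rfl fun p hp => ?_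
  split_ifs with hmp
  · exact sum_app_pair h hlam hpos hr hJ hm hp hmp
  · simp

/-- The action of `D` on the coefficients of a column-determinant. -/
theorem smul_sum_app_minor (h : Relations lam e G H T D v) (hlam : Monotone lam)
    (hpos : ∀ i, 0 < lam i) {k r : ℕ} (hk : 1 ≤ k)
    (hr : ∀ J : Finset (Fin n), #J + 1 = k → ∑ j ∈ J, (lam j - 1) ≤ r) :
    D • ∑ J ∈ powersetCard k univ, app v r (minor J e) =
      -((k - 1 : ℤ) • ∑ J ∈ powersetCard (k - 1) univ,
        (∑ m ∈ Jᶜ, (lam m : ℤ)) • app v r (minor J e)) := by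
  rw [smul_sum, sum_congr rfl fun J hJ =>
    smul_app_minor h hlam hpos hr (mem_powersetCard.mp hJ).2, sum_neg_distrib, ← smul_sum]
  congr 2
  simp only [sum_smul]
  rw [sum_sigma', sum_sigma']
  refine sum_bij' (fun x _ => ⟨x.1.erase x.2, x.2⟩) (fun x _ => ⟨insert x.2 x.1, x.2⟩) ?_ ?_ ?_ ?_ ?_
  · rintro ⟨J, m⟩ hx
    simp only [mem_sigma, mem_powersetCard_univ] at hx
    simp [card_erase_of_mem hx.2, hx.1]
  · rintro ⟨J, m⟩ hx
    simp only [mem_sigma, mem_powersetCard_univ, mem_compl] at hx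
    simp [card_insert_of_notMem hx.2, hx.1]
    lia
  · rintro ⟨J, m⟩ hx
    simp only [mem_sigma] at hx
    simp [insert_erase hx.2]
  · rintro ⟨J, m⟩ hx
    simp only [mem_sigma, mem_compl] at hx
    simp [erase_insert hx.2]
  · intros
    rfl

end Lowering

/-! ### Commutation relations in the vacuum module -/

namespace EnvDer

attribute [local instance] LieRing.ofAssociativeRing

variable {R L : Type*} [CommRing R] [LieRing L] [LieAlgebra R L]

/-- The enveloping algebra is generated by the Lie algebra. -/
theorem eq_top_of_ι_mem (S : Subalgebra R (UniversalEnvelopingAlgebra R L))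
    (h : ∀ x, UniversalEnvelopingAlgebra.ι R x ∈ S) (a : UniversalEnvelopingAlgebra R L) :
    a ∈ S := by
  let f : L →ₗ⁅R⁆ S :=
    { toFun := fun x => ⟨UniversalEnvelopingAlgebra.ι R x, h x⟩
      map_add' := fun x y => Subtype.ext (map_add _ x y)
      map_smul' := fun c x => Subtype.ext (map_smul _ c x)
      map_lie' := fun {x y} => Subtype.ext (LieHom.map_lie _ x y) }
  have hf : S.val.comp (UniversalEnvelopingAlgebra.lift R f) = AlgHom.id R _ := by
    ext x
    change ((UniversalEnvelopingAlgebra.lift R f) (UniversalEnvelopingAlgebra.ι R x) :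
      UniversalEnvelopingAlgebra R L) = UniversalEnvelopingAlgebra.ι R x
    rw [UniversalEnvelopingAlgebra.lift_ι_apply]
    rfl
  have := DFunLike.congr_fun hf a
  rw [AlgHom.id_apply] at this
  rw [← this]
  exact (UniversalEnvelopingAlgebra.lift R f a).2

/-- The extension of derivations to the enveloping algebra takes commutators to commutators. -/
theorem der_comm (D D' D'' : LieDerivation R L L) (c : ℤ)
    (h : ∀ x, D (D' x) - D' (D x) = c • D'' x) (a : UniversalEnvelopingAlgebra R L) :
    der D (der D' a) - der D' (der D a) = c • der D'' a := by
  let S : Subalgebra R (UniversalEnvelopingAlgebra R L) :=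
    { carrier := {a | der D (der D' a) - der D' (der D a) = c • der D'' a}
      mul_mem' := fun {a b} ha hb => by
        simp only [Set.mem_ofPred_eq] at ha hb ⊢
        simp only [der_mul, map_add]
        rw [smul_add, ← smul_mul_assoc, ← mul_smul_comm, ← ha, ← hb]
        noncomm_ring
      add_mem' := fun {a b} ha hb => by
        simp only [Set.mem_ofPred_eq] at ha hb ⊢
        simp only [map_add, smul_add, ← ha, ← hb]
        abel
      algebraMap_mem' := fun b => by
        simp [Algebra.algebraMap_eq_smul_one, der_one] }
  exact eq_top_of_ι_mem S (fun x => by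
    change der D (der D' _) - der D' (der D _) = c • der D'' _
    simp only [der_ι, ← map_sub, h, map_zsmul]) a

end EnvDer

namespace Affine

attribute [local instance] LieRing.ofAssociativeRing

variable {g : Type*} [LieRing g] [LieAlgebra ℂ g] (B : LinearMap.BilinForm ℂ g)
  (hB : B.lieInvariant g) (hs : B.IsSymm)

theorem witt_comm (m k : ℤ) (x : KM B hB hs) :
    witt B hB hs m (witt B hB hs k x) - witt B hB hs k (witt B hB hs m x) =
      (k - m : ℤ) • witt B hB hs (m + k) x := by
  induction x using KM_induction with
  | h0 => simp
  | hadd a b ha hb => simp only [map_add, smul_add, ← ha, ← hb]; abel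
  | hcen c => simp [witt_central]
  | hmon r X =>
    simp only [witt_mon, map_smul, add_assoc, add_comm k m]
    push_cast
    module

/-- The commutation relations of the Witt algebra on `V(g)`. -/
theorem wittOp_comm (m k : ℤ) (hm : -1 ≤ m) (hk : -1 ≤ k) (hmk : -1 ≤ m + k) :
    wittOp B hB hs m hm * wittOp B hB hs k hk - wittOp B hB hs k hk * wittOp B hB hs m hm =
      (k - m : ℤ) • wittOp B hB hs (m + k) hmk := by
  ext v
  obtain ⟨a, rfl⟩ := toVac_surjective B hB hs v
  simp only [LinearMap.sub_apply, Module.End.mul_apply, LinearMap.smul_apply, wittOp_toVac]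
  rw [← map_sub, EnvDer.der_comm _ _ _ _ (witt_comm B hB hs m k), map_zsmul]

theorem wittOp_comm_op (m : ℤ) (hm : -1 ≤ m) (r : ℤ) (X : g) :
    wittOp B hB hs m hm * op B hB hs r X - op B hB hs r X * wittOp B hB hs m hm =
      r • op B hB hs (r + m) X := by
  ext v
  simp only [LinearMap.sub_apply, Module.End.mul_apply, LinearMap.smul_apply, wittOp_op]
  rw [Int.cast_smul_eq_zsmul]
  abel

/-- The commutation relations of the operators `X[r]` in the cases when the central element does
not appear. -/
theorem op_comm (r s : ℤ) (h : r = 0 ∨ r + s ≠ 0) (X Y : g) :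
    op B hB hs r X * op B hB hs s Y - op B hB hs s Y * op B hB hs r X =
      op B hB hs (r + s) ⁅X, Y⁆ := by
  have h1 := mon_lie_mon B hB hs r s X Y
  rw [show (if r + s = 0 then (r : ℂ) * B X Y else 0) = 0 by
    rcases h with rfl | h
    · simp
    · simp [h], zero_smul, add_zero] at h1
  have h2 := congrArg (UniversalEnvelopingAlgebra.ι ℂ) h1
  rw [LieHom.map_lie, LieRing.of_associative_ring_bracket] at h2
  rw [op, op, op, ← map_mul (Algebra.lsmul ℂ ℂ (Vac B hB hs)),
    ← map_mul (Algebra.lsmul ℂ ℂ (Vac B hB hs)), ← map_sub, h2]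

theorem op_vac (r : ℤ) (hr : 0 ≤ r) (X : g) : op B hB hs r X (vac B hB hs) = 0 := by
  simp only [op, Algebra.lsmul_coe, vac, ← map_smul (toVac B hB hs), smul_eq_mul, mul_one]
  exact (Submodule.Quotient.mk_eq_zero _).mpr (Submodule.subset_span (Or.inl ⟨r, X, hr, rfl⟩))

theorem op_zero (r : ℤ) : op B hB hs r 0 = 0 := by
  rw [op, map_zero, map_zero, map_zero]

theorem op_sub (r : ℤ) (X Y : g) :
    op B hB hs r (X - Y) = op B hB hs r X - op B hB hs r Y := by
  rw [op, map_sub, map_sub, map_sub]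
  rfl

end Affine

namespace Pyramid

attribute [local instance] LieRing.ofAssociativeRing

variable {n : ℕ} (lam : Fin n → ℕ)

theorem E_eq_zero {i j : Fin n} {r : ℕ} (h : lam j ≤ r) : E lam i j r = 0 := by
  refine Subtype.ext ?_
  change Emat lam i j r = 0
  unfold Emat
  split_ifs
  · ext ⟨k, c⟩ ⟨l, d⟩
    simp only [Matrix.of_apply, Matrix.zero_apply, ite_eq_right_iff, one_ne_zero, imp_false]
    rintro ⟨rfl, rfl, h'⟩
    have := d.2
    lia
  · rfl

theorem Emat_apply {i j : Fin n} {r : ℕ} (hr : lam j - min (lam i) (lam j) ≤ r) (a b : Box lam) :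
    Emat lam i j r a b = if a.1 = i ∧ b.1 = j ∧ (b.2 : ℕ) = a.2 + r then 1 else 0 := by
  rw [Emat, if_pos hr, Matrix.of_apply]

theorem Emat_mul {i j k l : Fin n} {r s : ℕ} (hr : lam j - min (lam i) (lam j) ≤ r)
    (hs : lam l - min (lam k) (lam l) ≤ s) :
    Emat lam i j r * Emat lam k l s = if k = j then Emat lam i l (r + s) else 0 := by
  ext ⟨a, c⟩ ⟨b, d⟩
  rw [Matrix.mul_apply]
  simp only [Emat_apply lam hr, Emat_apply lam hs, mul_ite, mul_one, mul_zero, ← ite_and]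
  by_cases hk : k = j
  · subst hk
    rw [if_pos rfl, Emat_apply lam (by lia)]
    split_ifs with h2
    · obtain ⟨h3, h4, h2⟩ := h2
      simp only at h2 h3 h4
      subst h3 h4
      have := d.2
      have := c.2
      rw [Finset.sum_eq_single ⟨k, ⟨c + r, by lia⟩⟩]
      · rw [if_pos ⟨⟨rfl, rfl, by simp only; lia⟩, rfl, rfl, rfl⟩]
      · rintro ⟨k', f⟩ - hf
        rw [if_neg]
        rintro ⟨⟨rfl, -, -⟩, -, -, h3⟩
        exact hf (by congr 1; exact Fin.ext h3)
      · simp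
    · refine Finset.sum_eq_zero fun x _ => if_neg ?_
      rintro ⟨⟨-, h3, h4⟩, h5, -, h6⟩
      exact h2 ⟨h5, h3, by simp only at h4 h6 ⊢; lia⟩
  · rw [if_neg hk, Matrix.zero_apply]
    refine Finset.sum_eq_zero fun x _ => if_neg ?_
    rintro ⟨⟨h3, -, -⟩, -, h4, -⟩
    exact hk (h3.symm.trans h4)

theorem lie_E {i j k l : Fin n} {r s : ℕ} (hr : lam j - min (lam i) (lam j) ≤ r)
    (hs : lam l - min (lam k) (lam l) ≤ s) :
    ⁅E lam i j r, E lam k l s⁆ =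
      (if k = j then E lam i l (r + s) else 0) - if i = l then E lam k j (s + r) else 0 := by
  refine Subtype.ext ?_
  change Emat lam i j r * Emat lam k l s - Emat lam k l s * Emat lam i j r = _
  rw [Emat_mul lam hr hs, Emat_mul lam hs hr]
  split_ifs <;> simp [E]

open Polynomial Finset

theorem zsmul_mul_sub {R : Type*} [Ring R] (c : ℤ) (a b : R) :
    c • a * b - b * (c • a) = c • (a * b - b * a) := by
  rw [smul_mul_assoc, mul_smul_comm, smul_sub]

theorem comm_C_ite {R : Type*} [Ring R] {s t w : R} {d : ℤ} (h : s * t - t * s = d • w) (c : ℤ)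
    (p : Prop) [Decidable p] :
    C s * (if p then C (c • t) else 0) - (if p then C (c • t) else 0) * C s =
      if p then C ((d * c) • w) else 0 := by
  split_ifs
  · rw [← C_mul, ← C_mul, ← C_sub, mul_smul_comm, smul_mul_assoc, ← smul_sub, h, smul_smul,
      mul_comm c]
  · simp

variable [∀ i, NeZero (lam i)]

/-- The operator `t d/dt` on the vacuum module. -/
noncomputable def euler : Module.End ℂ (V lam) := Affine.wittOp _ _ _ 0 (by norm_num)

/-- The exponents of `u` in `E_{ij}(u)`. -/
noncomputable def exponents (i j : Fin n) : Finset ℕ := Ico (lam j - min (lam i) (lam j)) (lam j)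

theorem Epoly_eq (i j : Fin n) : Epoly lam i j =
    ∑ r ∈ exponents lam i j, monomial r (op lam (-1) (E lam i j r)) := rfl

/-- The entries of `mat` without the variable `x`. -/
noncomputable def entryPoly (i j : Fin n) : (Module.End ℂ (V lam))[X] :=
  (if i = j then C ((lam j : ℤ) • T lam) else 0) + Epoly lam i j

/-- The polynomial `F_{ij}(u)`, the sum of `E_{ij}^{(r)}[0] u^r`. -/
noncomputable def Fpoly (i j : Fin n) : (Module.End ℂ (V lam))[X] :=
  ∑ r ∈ exponents lam i j, monomial r (op lam 0 (E lam i j r))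

/-- The commutator of `Δ` with `entryPoly`. -/
noncomputable def lowered (i j : Fin n) : (Module.End ℂ (V lam))[X] :=
  (if i = j then C ((2 * lam j : ℤ) • euler lam) else 0) - Fpoly lam i j

/-- The polynomial which expresses the commutator of `F_{ij}(u)` and `E_{jl}(u)`. -/
noncomputable def Hpoly (i j l : Fin n) : (Module.End ℂ (V lam))[X] :=
  ∑ r ∈ exponents lam i j, ∑ s ∈ exponents lam j l, monomial (r + s) (op lam (-1) (E lam i l (r + s)))

theorem mat_eq : mat lam =
    Matrix.of fun i j => (if i = j then X else 0) + C (entryPoly lam i j) := by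
  ext1 i j
  simp only [mat, entryPoly, Matrix.of_apply, C_add]
  split_ifs with h
  · subst h
    rw [add_assoc, natCast_zsmul, Nat.cast_smul_eq_nsmul]
  · simp

theorem comm_T_op (r : ℤ) (X : centralizer lam) :
    T lam * op lam r X - op lam r X * T lam = (-r) • op lam (r - 1) X := by
  have := Affine.wittOp_comm_op (form lam) (form_lieInvariant lam) (form_isSymm lam) (-1) le_rfl r X
  rw [T, op, neg_mul, mul_neg, sub_neg_eq_add, neg_smul, sub_eq_add_neg r 1, op, ← this]
  abel

theorem comm_Delta_op (r : ℤ) (X : centralizer lam) :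
    Delta lam * op lam r X - op lam r X * Delta lam = r • op lam (r + 1) X :=
  Affine.wittOp_comm_op _ _ _ _ _ r X

theorem comm_euler_op (r : ℤ) (X : centralizer lam) :
    euler lam * op lam r X - op lam r X * euler lam = r • op lam r X := by
  have := Affine.wittOp_comm_op (form lam) (form_lieInvariant lam) (form_isSymm lam) 0
    (by norm_num) r X
  rwa [add_zero] at this

theorem comm_Delta_T : Delta lam * T lam - T lam * Delta lam = (2 : ℤ) • euler lam := by
  have := Affine.wittOp_comm (form lam) (form_lieInvariant lam) (form_isSymm lam) 1 (-1)
    (by norm_num) le_rfl (by norm_num)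
  simp only [add_neg_cancel] at this
  rw [T, mul_neg, neg_mul, sub_neg_eq_add, ← sub_eq_neg_add, ← neg_sub, Delta, this, euler]
  module

theorem comm_euler_T : euler lam * T lam - T lam * euler lam = -T lam := by
  have := Affine.wittOp_comm (form lam) (form_lieInvariant lam) (form_isSymm lam) 0 (-1)
    (by norm_num) le_rfl (by norm_num)
  simp only [zero_add, sub_zero, neg_smul, one_smul] at this
  rw [T, mul_neg, neg_mul, sub_neg_eq_add, ← sub_eq_neg_add, ← neg_sub, euler, this]

theorem comm_op_op (r s : ℤ) (h : r = 0 ∨ r + s ≠ 0) (X Y : centralizer lam) :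
    op lam r X * op lam s Y - op lam s Y * op lam r X = op lam (r + s) ⁅X, Y⁆ :=
  Affine.op_comm _ _ _ r s h X Y

theorem op_zero (r : ℤ) : op lam r 0 = 0 := Affine.op_zero _ _ _ r

theorem op_sub (r : ℤ) (X Y : centralizer lam) : op lam r (X - Y) = op lam r X - op lam r Y :=
  Affine.op_sub _ _ _ r X Y

theorem op_ite (r : ℤ) (p : Prop) [Decidable p] (X : centralizer lam) :
    op lam r (if p then X else 0) = if p then op lam r X else 0 := by
  split_ifs
  · rfl
  · exact op_zero lam r

theorem comm_Fpoly_Epoly (i j k l : Fin n) :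
    Fpoly lam i j * Epoly lam k l - Epoly lam k l * Fpoly lam i j =
      (if k = j then Hpoly lam i j l else 0) - if i = l then Hpoly lam k i j else 0 := by
  have h1 (r s : ℕ) (hr : r ∈ exponents lam i j) (hs : s ∈ exponents lam k l) :
      monomial r (op lam 0 (E lam i j r)) * monomial s (op lam (-1) (E lam k l s)) -
      monomial s (op lam (-1) (E lam k l s)) * monomial r (op lam 0 (E lam i j r)) =
      (if k = j then monomial (r + s) (op lam (-1) (E lam i l (r + s))) else 0) -
      if i = l then monomial (s + r) (op lam (-1) (E lam k j (s + r))) else 0 := by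
    rw [monomial_mul_monomial, monomial_mul_monomial, add_comm s r, ← map_sub,
      comm_op_op lam 0 (-1) (Or.inl rfl), lie_E lam (mem_Ico.mp hr).1 (mem_Ico.mp hs).1, op_sub,
      op_ite, op_ite, map_sub, zero_add, add_comm s r]
    congr 1 <;> split_ifs <;> simp
  rw [Epoly_eq, Fpoly, sum_mul_sum, sum_mul_sum, sum_comm (s := exponents lam k l),
    ← sum_sub_distrib]
  simp only [← sum_sub_distrib]
  rw [sum_congr rfl fun r hr => sum_congr rfl fun s hs => h1 r s hr hs]
  simp only [sum_sub_distrib]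
  congr 1
  · split_ifs with h
    · subst h; rfl
    · simp
  · split_ifs with h
    · subst h; rw [sum_comm]; rfl
    · simp

theorem comm_Fpoly_T (i j : Fin n) :
    Fpoly lam i j * C (T lam) - C (T lam) * Fpoly lam i j = 0 := by
  rw [Fpoly, sum_mul, mul_sum, ← sum_sub_distrib]
  refine sum_eq_zero fun r _ => ?_
  rw [monomial_mul_C, C_mul_monomial, ← map_sub, ← neg_sub, comm_T_op]
  simp

theorem comm_Epoly {S : Module.End ℂ (V lam)} {c m : ℤ}
    (h : ∀ X : centralizer lam, S * op lam (-1) X - op lam (-1) X * S = c • op lam m X)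
    (i j : Fin n) : C S * Epoly lam i j - Epoly lam i j * C S =
      c • ∑ r ∈ exponents lam i j, monomial r (op lam m (E lam i j r)) := by
  rw [Epoly_eq, sum_mul, mul_sum, ← sum_sub_distrib, smul_sum]
  refine sum_congr rfl fun r _ => ?_
  rw [monomial_mul_C, C_mul_monomial, ← map_sub, h, map_zsmul]

theorem comm_Delta_entryPoly (i j : Fin n) :
    C (Delta lam) * entryPoly lam i j - entryPoly lam i j * C (Delta lam) = lowered lam i j := by
  have h := comm_Epoly lam (comm_Delta_op lam (-1)) i j
  have h' := comm_C_ite (comm_Delta_T lam) (lam j) (i = j)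
  rw [neg_add_cancel, neg_one_smul] at h
  rw [entryPoly, lowered, mul_add, add_mul, add_sub_add_comm, h, h', ← sub_eq_add_neg]
  rfl

theorem comm_euler_entryPoly (i j : Fin n) :
    C (euler lam) * entryPoly lam i j - entryPoly lam i j * C (euler lam) =
      -entryPoly lam i j := by
  have h := comm_Epoly lam (comm_euler_op lam (-1)) i j
  have h' := comm_C_ite ((comm_euler_T lam).trans (neg_one_smul ℤ _).symm) (lam j) (i = j)
  rw [← Epoly_eq, neg_one_smul] at h
  rw [entryPoly, mul_add, add_mul, add_sub_add_comm, h, h', neg_add]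
  congr 1
  split_ifs
  · rw [neg_one_mul, neg_smul, C_neg]
  · rw [neg_zero]

theorem C_zsmul {R : Type*} [Ring R] (c : ℤ) (a : R) : C (c • a) = c • C a :=
  map_zsmul C c a

theorem comm_lowered_entryPoly (i j k l : Fin n) :
    lowered lam i j * entryPoly lam k l - entryPoly lam k l * lowered lam i j =
      (if i = j then (-2 * lam j : ℤ) • entryPoly lam k l else 0) -
        (if k = j then Hpoly lam i j l else 0) + if i = l then Hpoly lam k i j else 0 := by
  have h1 : Fpoly lam i j * entryPoly lam k l - entryPoly lam k l * Fpoly lam i j =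
      (if k = j then Hpoly lam i j l else 0) - if i = l then Hpoly lam k i j else 0 := by
    have h : Fpoly lam i j * (if k = l then C ((lam l : ℤ) • T lam) else 0) -
        (if k = l then C ((lam l : ℤ) • T lam) else 0) * Fpoly lam i j = 0 := by
      split_ifs
      · rw [C_zsmul, ← neg_sub, zsmul_mul_sub, ← neg_sub, comm_Fpoly_T, neg_zero, smul_zero,
          neg_zero]
      · rw [mul_zero, zero_mul, sub_zero]
    rw [entryPoly, mul_add, add_mul, add_sub_add_comm, comm_Fpoly_Epoly, h, zero_add]
  have h2 : (if i = j then C ((2 * lam j : ℤ) • euler lam) else 0) * entryPoly lam k l -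
      entryPoly lam k l * (if i = j then C ((2 * lam j : ℤ) • euler lam) else 0) =
      if i = j then (-2 * lam j : ℤ) • entryPoly lam k l else 0 := by
    split_ifs
    · rw [C_zsmul, zsmul_mul_sub, comm_euler_entryPoly, smul_neg, neg_mul, neg_smul]
    · rw [mul_zero, zero_mul, sub_zero]
  rw [lowered, sub_mul, mul_sub, sub_sub_sub_comm, h1, h2]
  abel

theorem coeff_Epoly (i j : Fin n) :
    (Epoly lam i j).coeff (lam j - 1) = op lam (-1) (E lam i j (lam j - 1)) := by
  have hi := Nat.pos_of_neZero (lam i)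
  have hj := Nat.pos_of_neZero (lam j)
  rw [Epoly_eq, finsetSum_coeff, sum_eq_single (lam j - 1)]
  · simp
  · intro r _ hr
    rw [coeff_monomial, if_neg hr]
  · intro h
    exact absurd (mem_Ico.mpr (by lia)) h

theorem coeff_entryPoly (i j : Fin n) : (entryPoly lam i j).coeff (lam j - 1) =
    (if i = j ∧ lam j = 1 then T lam else 0) + op lam (-1) (E lam i j (lam j - 1)) := by
  have hj := Nat.pos_of_neZero (lam j)
  rw [entryPoly, coeff_add, coeff_Epoly]
  congr 1
  by_cases h : i = j
  · by_cases h1 : lam j = 1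
    · simp [h, h1]
    · rw [if_pos h, if_neg (by simp [h1]), coeff_C_of_ne_zero (by lia)]
  · simp [h]

theorem natDegree_entryPoly (i j : Fin n) : (entryPoly lam i j).natDegree ≤ lam j - 1 := by
  refine natDegree_add_le_of_degree_le ?_ ?_
  · split_ifs
    · exact (natDegree_C _).trans_le (Nat.zero_le _)
    · exact natDegree_zero.trans_le (Nat.zero_le _)
  · rw [Epoly_eq]
    refine natDegree_sum_le_of_forall_le _ _ fun r hr => (natDegree_monomial_le _).trans ?_
    have := (mem_Ico.mp hr).2
    lia

theorem natDegree_Hpoly (i j l : Fin n) : (Hpoly lam i j l).natDegree ≤ lam l - 1 := by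
  refine natDegree_sum_le_of_forall_le _ _ fun r _ =>
    natDegree_sum_le_of_forall_le _ _ fun s _ => ?_
  by_cases h : lam l ≤ r + s
  · simp [E_eq_zero lam h, op_zero]
  · exact (natDegree_monomial_le _).trans (by lia)

theorem coeff_Hpoly (i j l : Fin n) (hi : lam j ≤ lam i) (hl : lam j ≤ lam l) :
    (Hpoly lam i j l).coeff (lam l - 1) =
      (lam j : ℤ) • op lam (-1) (E lam i l (lam l - 1)) := by
  have h1 (r : ℕ) (hr : r ∈ exponents lam i j) : (∑ s ∈ exponents lam j l,
      monomial (r + s) (op lam (-1) (E lam i l (r + s)))).coeff (lam l - 1) =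
      op lam (-1) (E lam i l (lam l - 1)) := by
    have hr' := (mem_Ico.mp hr).2
    rw [finsetSum_coeff, sum_eq_single (lam l - 1 - r)]
    · rw [coeff_monomial, if_pos (by lia), show r + (lam l - 1 - r) = lam l - 1 by lia]
    · intro s hs hne
      rw [coeff_monomial, if_neg (by lia)]
    · intro h
      exact absurd (mem_Ico.mpr (by lia)) h
  rw [Hpoly, finsetSum_coeff, sum_congr rfl h1, sum_const, exponents, Nat.card_Ico, natCast_zsmul,
    min_eq_right hi, Nat.sub_self, Nat.sub_zero]

theorem comm_coeff_entryPoly (i j k l : Fin n) :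
    (entryPoly lam i j).coeff (lam j - 1) * (entryPoly lam k l).coeff (lam l - 1) -
      (entryPoly lam k l).coeff (lam l - 1) * (entryPoly lam i j).coeff (lam j - 1) =
    (if k = j ∧ lam j = 1 then op lam (-2) (E lam i l (lam l - 1)) else 0) -
    (if i = l ∧ lam l = 1 then op lam (-2) (E lam k j (lam j - 1)) else 0) +
    ((if i = j ∧ lam j = 1 then op lam (-2) (E lam k l (lam l - 1)) else 0) -
    (if k = l ∧ lam l = 1 then op lam (-2) (E lam i j (lam j - 1)) else 0)) := by
  have hpos (i : Fin n) := Nat.pos_of_neZero (lam i)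
  have hE (a b c : Fin n) : E lam a b (lam b - 1 + (lam c - 1)) =
      if lam c = 1 then E lam a b (lam b - 1) else 0 := by
    have := hpos b
    have := hpos c
    split_ifs with h
    · rw [h, Nat.sub_self, add_zero]
    · exact E_eq_zero lam (by lia)
  have h1 : op lam (-1) (E lam i j (lam j - 1)) * op lam (-1) (E lam k l (lam l - 1)) -
      op lam (-1) (E lam k l (lam l - 1)) * op lam (-1) (E lam i j (lam j - 1)) =
      (if k = j ∧ lam j = 1 then op lam (-2) (E lam i l (lam l - 1)) else 0) -
      (if i = l ∧ lam l = 1 then op lam (-2) (E lam k j (lam j - 1)) else 0) := by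
    have := hpos i
    have := hpos j
    have := hpos k
    have := hpos l
    rw [comm_op_op lam _ _ (Or.inr (by norm_num)), lie_E lam (by lia) (by lia), op_sub, op_ite,
      op_ite, add_comm (lam j - 1), hE, add_comm (lam l - 1), hE, op_ite, op_ite, ite_and, ite_and]
    norm_num
  have hT (p : Prop) [Decidable p] (X : centralizer lam) :
      (if p then T lam else 0) * op lam (-1) X - op lam (-1) X * (if p then T lam else 0) =
      if p then op lam (-2) X else 0 := by
    split_ifs
    · rw [comm_T_op]; norm_num
    · simp
  have hTT (p q : Prop) [Decidable p] [Decidable q] :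
      (if p then T lam else 0) * (if q then T lam else 0) =
      (if q then T lam else 0) * (if p then T lam else 0) := by
    split_ifs <;> simp
  rw [coeff_entryPoly, coeff_entryPoly, ← h1, ← hT, ← hT, mul_add, add_mul, add_mul, mul_add,
    add_mul, add_mul, hTT]
  abel

theorem coeff_Fpoly_vac (i j : Fin n) (r : ℕ) :
    (Fpoly lam i j).coeff r • vac lam = 0 := by
  rw [Fpoly, finsetSum_coeff, sum_smul]
  refine sum_eq_zero fun s _ => ?_
  rw [coeff_monomial]
  split_ifs
  · exact Affine.op_vac _ _ _ 0 le_rfl _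
  · exact zero_smul _ _

theorem relations : Lowering.Relations lam (entryPoly lam) (lowered lam) (Hpoly lam) (T lam)
    (Delta lam) (vac lam) where
  natDegree_e := natDegree_entryPoly lam
  natDegree_H := natDegree_Hpoly lam
  coeff_H i j l hi hl := by rw [coeff_Hpoly lam i j l hi hl, coeff_entryPoly, add_sub_cancel_left]
  manin i j k l := by rw [comm_coeff_entryPoly, comm_coeff_entryPoly]; abel
  D_smul := Affine.wittOp_vac _ _ _ _ _
  comm_D := comm_Delta_entryPoly lam
  G_smul i j r := by
    have h0 : euler lam • vac lam = 0 := Affine.wittOp_vac _ _ _ _ _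
    rw [lowered, coeff_sub, sub_smul, coeff_Fpoly_vac, sub_zero]
    split_ifs
    · rw [coeff_C]
      split_ifs
      · rw [smul_assoc, h0, smul_zero]
      · exact zero_smul _ _
    · exact zero_smul _ _
  comm_G := comm_lowered_entryPoly lam

theorem phi_eq (k r : ℕ) (hk : k ≤ n) : phi lam k r =
    ∑ J ∈ powersetCard k univ,
      Lowering.app (vac lam) r (OrderedProd.minor J (entryPoly lam)) := by
  rw [phi, mat_eq, OrderedProd.coeff_columnDet _ k hk, finsetSum_coeff, LinearMap.sum_apply]
  rfl

/-! ### The largest degree -/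

variable {lam}

theorem filter_eq_Ioi {k : ℕ} (hk : 1 ≤ k) (hkn : k ≤ n) :
    ({i : Fin n | n < i.val + k} : Finset (Fin n)) = Ioi ⟨n - k, by lia⟩ := by
  ext i
  simp only [mem_filter_univ, mem_Ioi, Fin.lt_def]
  lia

theorem card_filter_lt {k : ℕ} (hk : 1 ≤ k) (hkn : k ≤ n) :
    #({i : Fin n | n < i.val + k} : Finset (Fin n)) + 1 = k := by
  rw [filter_eq_Ioi hk hkn, Fin.card_Ioi]
  simp only
  lia

/-- The sums of `k - 1` values of a monotone function are bounded by the sum of the last ones. -/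
theorem sum_le_sum_filter {f : Fin n → ℕ} (hf : Monotone f) {k : ℕ} (hk : 1 ≤ k) (hkn : k ≤ n)
    {J : Finset (Fin n)} (hJ : #J + 1 = k) :
    ∑ j ∈ J, f j ≤ ∑ i : Fin n with n < i.val + k, f i := by
  have hS := card_filter_lt hk hkn
  rw [filter_eq_Ioi hk hkn] at hS ⊢
  set c : Fin n := ⟨n - k, by lia⟩
  rw [← sum_sdiff_le_sum_sdiff]
  calc ∑ j ∈ J \ Ioi c, f j ≤ #(J \ Ioi c) • f c :=
        sum_le_card_nsmul _ _ _ fun x hx => hf (by simpa using (mem_sdiff.mp hx).2)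
    _ = #(Ioi c \ J) • f c := by rw [card_sdiff_comm (by lia)]
    _ ≤ ∑ i ∈ Ioi c \ J, f i :=
        card_nsmul_le_sum _ _ _ fun x hx => hf (mem_Ioi.mp (mem_sdiff.mp hx).1).le

end Pyramid

/-- The rows are numbered from `0`, so that the first two sums are
`lam_{n-k+2} + … + lam_n` and the last one is `lam_1 + … + lam_{n-k+1}` in the numbering from `1`. -/
theorem lemma2p3 {n : ℕ} (lam : Fin n → ℕ) [∀ i, NeZero (lam i)] (hlam : Monotone lam)
    (k : ℕ) (hk : 1 ≤ k) (hkn : k ≤ n) (r : ℕ) :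
    ((r : ℤ) > (∑ i : Fin n with n < i.val + k, (lam i : ℤ)) - k + 1 →
      Pyramid.Delta lam (Pyramid.phi lam k r) = 0) ∧
    ((r : ℤ) = (∑ i : Fin n with n < i.val + k, (lam i : ℤ)) - k + 1 →
      Pyramid.Delta lam (Pyramid.phi lam k r) =
        (-(((k : ℂ) - 1) * ∑ i : Fin n with i.val + k ≤ n, (lam i : ℂ))) •
          Pyramid.phi lam (k - 1) r) := by
  have hpos (i : Fin n) : 0 < lam i := Nat.pos_of_neZero _
  -- The sum of `lam j - 1` over a set is the sum of `lam j` minus the number of elements.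
  have hsub (J : Finset (Fin n)) :
      ((∑ j ∈ J, (lam j - 1) : ℕ) : ℤ) = (∑ j ∈ J, (lam j : ℤ)) - J.card := by
    push_cast [Nat.cast_sub (hpos _)]
    simp
  have hS := hsub {i : Fin n | n < i.val + k}
  have hcard := Pyramid.card_filter_lt hk hkn
  have hbound (J : Finset (Fin n)) (hJ : J.card + 1 = k) :=
    Pyramid.sum_le_sum_filter (f := fun j => lam j - 1)
      (fun _ _ h => Nat.sub_le_sub_right (hlam h) 1) hk hkn hJ
  have hmain (hr : ∑ i : Fin n with n < i.val + k, (lam i - 1) ≤ r) :=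
    Lowering.smul_sum_app_minor (Pyramid.relations lam) hlam hpos hk
      fun J hJ => (hbound J hJ).trans hr
  rw [← Pyramid.phi_eq lam k r hkn] at hmain
  change _ → Pyramid.Delta lam (Pyramid.phi lam k r) = _ at hmain
  constructor
  · intro h
    rw [hmain (by lia), Finset.sum_eq_zero, smul_zero, neg_zero]
    intro J hJ
    have := hbound J (by rw [(Finset.mem_powersetCard.mp hJ).2]; lia)
    rw [Lowering.app_minor (Pyramid.relations lam) (by lia), if_neg (by lia), smul_zero]
  · intro h
    rw [hmain (by lia), Pyramid.phi_eq lam (k - 1) r (by lia)]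
    have key (J : Finset (Fin n)) (hJ : J ∈ Finset.powersetCard (k - 1) Finset.univ) :
        (∑ m ∈ Jᶜ, (lam m : ℤ)) • Lowering.app (Pyramid.vac lam) r
          (OrderedProd.minor J (Pyramid.entryPoly lam)) =
        (∑ i : Fin n with i.val + k ≤ n, (lam i : ℤ)) • Lowering.app (Pyramid.vac lam) r
          (OrderedProd.minor J (Pyramid.entryPoly lam)) := by
      have hJ' : J.card + 1 = k := by rw [(Finset.mem_powersetCard.mp hJ).2]; lia
      have hb := hbound J hJ'
      rw [Lowering.app_minor (Pyramid.relations lam) (by lia)]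
      split_ifs with ht
      · congr 1
        have h1 := hsub J
        have h2 := Finset.sum_add_sum_compl J fun m => (lam m : ℤ)
        have h3 := Finset.sum_filter_add_sum_filter_not Finset.univ
          (fun i : Fin n => n < i.val + k) fun m => (lam m : ℤ)
        simp only [not_lt] at h3
        lia
      · rw [smul_zero, smul_zero]
    rw [Finset.sum_congr rfl key, ← Finset.smul_sum, smul_smul, ← neg_smul,
      ← Int.cast_smul_eq_zsmul ℂ]
    push_cast
    rfl
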